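/- Let $\Bbbk$ be an algebraically closed field of characteristic $0$ and let $p<q$ be odd primes. A quasitriangular structure on a Hopf algebra $H$ is an invertible $R\in H\otimes H$ with $(\Delta\otimes\mathrm{id})(R)=R_{13}R_{23}$, $(\mathrm{id}\otimes\Delta)(R)=R_{13}R_{12}$ and $\Delta^{op}(h)R=R\Delta(h)$ for all $h\in H$. A bicharacter on a group $K$ is a map $w:K\times K\to\Bbbk^\times$ that is multiplicative in each argument. For a finite abelian normal subgroup $K$ of a group $G$, an indexing of the primitive idempotents of $\Bbbk[K]$ by $K$ is given by a group isomorphism $\theta:K\to\mathrm{Hom}(K,\Bbbk^\times)$ via $e_a=|K|^{-1}\sum_{x\in K}\theta_a(x^{-1})\,x$; it is called compatible with conjugation if for every $x\in G$ there is $y\in G$ such that $x e_a x^{-1}=e_{yay^{-1}}$ for all $a\in K$. Consider the following groups $G$ with subgroups $K$ and conditions (C) on a bicharacter $w$ on $K$, where $m,n\in\mathbb N$: (1) $p\mid q^2-1$, $m^p\equiv1$, $m\not\equiv1\pmod{q^2}$; $G=\beta_3=\langle s,t\mid s^{q^2}=t^p=1,\ tst^{-1}=s^m\rangle$; $K=\langle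 s\rangle$; (C): $w(s^m,s^m)=w(s,s)$. (2) $p\mid q-1$, $m^p\equiv1$, $m\not\equiv1\pmod q$; $G=\beta_4=\langle s,t,u\mid s^q=t^q=u^p=1,\ tst^{-1}=s,\ usu^{-1}=s,\ utu^{-1}=t^m\rangle$; $K=\langle s,t\rangle$; (C): $w(s,t^m)=w(s,t)$, $w(t^m,s)=w(t,s)$, $w(t^m,t^m)=w(t,t)$. (3) $p\mid q-1$, $m^p\equiv1$, $m\not\equiv1\pmod q$; $G=\beta_5=\langle s,t,u\mid s^q=t^q=u^p=1,\ tst^{-1}=s,\ usu^{-1}=s^m,\ utu^{-1}=t^m\rangle$; $K=\langle s,t\rangle$; (C): $w(s^m,s^m)=w(s,s)$, $w(s^m,t^m)=w(s,t)$, $w(t^m,s^m)=w(t,s)$, $w(t^m,t^m)=w(t,t)$. (4) $p\mid q-1$, $m^p\equiv n^p\equiv1$, $m\not\equiv1$, $n\not\equiv1$, $m\not\equiv n\pmod q$; $G=\beta_6=\langle s,t,u\mid s^q=t^q=u^p=1,\ tst^{-1}=s,\ usu^{-1}=s^m,\ utu^{-1}=t^n\rangle$; $K=\langle s,t\rangle$;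 (C): $w(s^m,s^m)=w(s,s)$, $w(s^m,t^n)=w(s,t)$, $w(t^n,s^m)=w(t,s)$, $w(t^n,t^n)=w(t,t)$. (5) $p\mid q+1$; $G=\beta_7=\langle s,t,u\mid s^q=t^q=u^p=1,\ tst^{-1}=s,\ usu^{-1}=t,\ utu^{-1}=s^mt^n\rangle$, where $m,n$ are such that $G$ has order $pq^2$; $K=\langle s,t\rangle$; (C): $w(t,t)=w(s,s)$, $w(t,s^mt^n)=w(s,t)$, $w(s^mt^n,t)=w(t,s)$, $w(s^mt^n,s^mt^n)=w(t,t)$. In each of these cases, $K$ is the largest nontrivial abelian normal subgroup of $G$ (it contains every abelian normal subgroup), indexings of the idempotents of $\Bbbk[K]$ by $K$ that are compatible with conjugation exist, and for each such indexing the quasitriangular structures on the group algebra $\Bbbk[G]$ are exactly the elements $R=\sum_{g,h\in K}w(g,h)\,e_g\otimes e_h$ where $w$ is a bicharacter on $K$ satisfying (C). -/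

import Mathlib

open scoped TensorProduct

noncomputable section

/-! ### Quasitriangular structures on a Hopf algebra -/

section Quasitriangular

variable (k : Type*) {H : Type*} [Field k] [Ring H] [HopfAlgebra k H]

/-- `R₁₂ = ∑ R⁽¹⁾ ⊗ R⁽²⁾ ⊗ 1`. -/
def R12 (R : H ⊗[k] H) : H ⊗[k] (H ⊗[k] H) :=
  TensorProduct.assoc k H H H (R ⊗ₜ[k] (1 : H))

/-- `R₁₃ = ∑ R⁽¹⁾ ⊗ 1 ⊗ R⁽²⁾`. -/
def R13 (R : H ⊗[k] H) : H ⊗[k] (H ⊗[k] H) :=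
  (TensorProduct.mk k H H 1).lTensor H R

/-- `R₂₃ = ∑ 1 ⊗ R⁽¹⁾ ⊗ R⁽²⁾`. -/
def R23 (R : H ⊗[k] H) : H ⊗[k] (H ⊗[k] H) :=
  (1 : H) ⊗ₜ[k] R

/-- `R` is a quasitriangular structure (universal `R`-matrix) on the Hopf algebra `H`. -/
structure IsQuasitriangularStructure (R : H ⊗[k] H) : Prop where
  isUnit : IsUnit R
  /-- `(Δ ⊗ id)(R) = R₁₃ R₂₃` -/
  comul_left :
    TensorProduct.assoc k H H H ((Coalgebra.comul (R := k) (A := H)).rTensor H R) =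
      R13 k R * R23 k R
  /-- `(id ⊗ Δ)(R) = R₁₃ R₁₂` -/
  comul_right :
    (Coalgebra.comul (R := k) (A := H)).lTensor H R = R13 k R * R12 k R
  /-- `Δᵒᵖ(h) R = R Δ(h)` -/
  comul_op : ∀ h : H,
    TensorProduct.comm k H H (Coalgebra.comul (R := k) h) * R = R * Coalgebra.comul (R := k) h

end Quasitriangular

/-! ### Elements of `k[G] ⊗ k[G]` built from a bicharacter of a finite abelian subgroup -/

section Subgroups

variable {k : Type*} [Field k] {G : Type*} [Group G] {K : Subgroup G}

/-- `K` is the largest nontrivial abelian normal subgroup of `G`. -/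
structure IsLargestAbelianNormal (K : Subgroup G) : Prop where
  normal : K.Normal
  comm : ∀ x ∈ K, ∀ y ∈ K, x * y = y * x
  ne_bot : K ≠ ⊥
  le : ∀ N : Subgroup G, N.Normal → (∀ x ∈ N, ∀ y ∈ N, x * y = y * x) → N ≤ K

/-- An indexing of the characters of `K` by the elements of `K` is a group isomorphism `θ` from `K`
to its character group. The primitive idempotent of `k[K] ⊆ k[G]` with index `a` is
`e_a = |K|⁻¹ ∑_{x ∈ K} θ_a(x⁻¹) x`. (The finite sum is meant for finite `K`.) -/
def idem (θ : K ≃* (K →* kˣ)) (a : K) : MonoidAlgebra k G :=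
  (Nat.card K : k)⁻¹ • ∑ᶠ x : K, MonoidAlgebra.single (x : G) ((θ a x⁻¹ : kˣ) : k)

/-- The indexing `a ↦ e_a` is compatible with conjugation: conjugating the idempotents by an element
`x` of `G` amounts to conjugating their indices by some element `y` of `G`, that is
`x e_a x⁻¹ = e_{y a y⁻¹}` for all `a ∈ K`. -/
def IsConjCompatible (θ : K ≃* (K →* kˣ)) : Prop :=
  ∀ x : G, ∃ y : G, ∀ a : K, ∃ b : K, (b : G) = y * a * y⁻¹ ∧
    MonoidAlgebra.single x (1 : k) * idem θ a * MonoidAlgebra.single x⁻¹ (1 : k) = idem θ b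

/-- `∑_{g,h ∈ K} w(g,h) e_g ⊗ e_h` -/
def bicharElement (θ : K ≃* (K →* kˣ)) (w : K →* K →* kˣ) :
    MonoidAlgebra k G ⊗[k] MonoidAlgebra k G :=
  ∑ᶠ gh : K × K, ((w gh.1 gh.2 : kˣ) : k) • (idem θ gh.1 ⊗ₜ[k] idem θ gh.2)

variable (k K) in
/-- Conjugation-compatible indexings of the idempotents of `k[K]` exist, and for each of them the
quasitriangular structures on `k[G]` are exactly the elements `∑_{g,h ∈ K} w(g,h) e_g ⊗ e_h` where
`w` is a bicharacter on `K` that satisfies the condition `C`. -/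
def QuasitriangularStructuresGivenBy (C : (K →* K →* kˣ) → Prop) : Prop :=
  (∃ θ : K ≃* (K →* kˣ), IsConjCompatible θ) ∧
    ∀ θ : K ≃* (K →* kˣ), IsConjCompatible θ →
      ∀ R : MonoidAlgebra k G ⊗[k] MonoidAlgebra k G,
        IsQuasitriangularStructure k R ↔ ∃ w : K →* K →* kˣ, C w ∧ R = bicharElement θ w

/-- The generator `s`, as an element of `⟨s⟩`. -/
def inClosure (s : G) : Subgroup.closure ({s} : Set G) :=
  ⟨s, Subgroup.subset_closure (Set.mem_singleton s)⟩

/-- The first generator, as an element of `⟨s, t⟩`. -/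
def inClosureFst (s t : G) : Subgroup.closure ({s, t} : Set G) :=
  ⟨s, Subgroup.subset_closure (Set.mem_insert s {t})⟩

/-- The second generator, as an element of `⟨s, t⟩`. -/
def inClosureSnd (s t : G) : Subgroup.closure ({s, t} : Set G) :=
  ⟨t, Subgroup.subset_closure (Set.mem_insert_of_mem s (Set.mem_singleton t))⟩

end Subgroups

/-! ### The groups, by generators and relations -/

/-- The relators of `⟨s, t | s^(q²) = t^p = 1, t s t⁻¹ = s^m⟩`, where `s, t` are the generators
with index `0, 1`. -/
def beta3Rels (p q m : ℕ) : Set (FreeGroup (Fin 2)) :=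
  let s := FreeGroup.of 0
  let t := FreeGroup.of 1
  {s ^ q ^ 2, t ^ p, t * s * t⁻¹ * (s ^ m)⁻¹}

abbrev Beta3 (p q m : ℕ) : Type := PresentedGroup (beta3Rels p q m)

/-- The relators of `⟨s, t, u | s^q = t^q = u^p = 1, t s t⁻¹ = s, u s u⁻¹ = s, u t u⁻¹ = t^m⟩`,
where `s, t, u` are the generators with index `0, 1, 2`. -/
def beta4Rels (p q m : ℕ) : Set (FreeGroup (Fin 3)) :=
  let s := FreeGroup.of 0
  let t := FreeGroup.of 1
  let u := FreeGroup.of 2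
  {s ^ q, t ^ q, u ^ p, t * s * t⁻¹ * s⁻¹, u * s * u⁻¹ * s⁻¹, u * t * u⁻¹ * (t ^ m)⁻¹}

abbrev Beta4 (p q m : ℕ) : Type := PresentedGroup (beta4Rels p q m)

/-- The relators of `⟨s, t, u | s^q = t^q = u^p = 1, t s t⁻¹ = s, u s u⁻¹ = s^m, u t u⁻¹ = t^m⟩`,
where `s, t, u` are the generators with index `0, 1, 2`. -/
def beta5Rels (p q m : ℕ) : Set (FreeGroup (Fin 3)) :=
  let s := FreeGroup.of 0
  let t := FreeGroup.of 1
  let u := FreeGroup.of 2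
  {s ^ q, t ^ q, u ^ p, t * s * t⁻¹ * s⁻¹, u * s * u⁻¹ * (s ^ m)⁻¹, u * t * u⁻¹ * (t ^ m)⁻¹}

abbrev Beta5 (p q m : ℕ) : Type := PresentedGroup (beta5Rels p q m)

/-- The relators of `⟨s, t, u | s^q = t^q = u^p = 1, t s t⁻¹ = s, u s u⁻¹ = s^m, u t u⁻¹ = t^n⟩`,
where `s, t, u` are the generators with index `0, 1, 2`. -/
def beta6Rels (p q m n : ℕ) : Set (FreeGroup (Fin 3)) :=
  let s := FreeGroup.of 0
  let t := FreeGroup.of 1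
  let u := FreeGroup.of 2
  {s ^ q, t ^ q, u ^ p, t * s * t⁻¹ * s⁻¹, u * s * u⁻¹ * (s ^ m)⁻¹, u * t * u⁻¹ * (t ^ n)⁻¹}

abbrev Beta6 (p q m n : ℕ) : Type := PresentedGroup (beta6Rels p q m n)

/-- The relators of `⟨s, t, u | s^q = t^q = u^p = 1, t s t⁻¹ = s, u s u⁻¹ = t, u t u⁻¹ = s^m t^n⟩`,
where `s, t, u` are the generators with index `0, 1, 2`. -/
def beta7Rels (p q m n : ℕ) : Set (FreeGroup (Fin 3)) :=
  let s := FreeGroup.of 0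
  let t := FreeGroup.of 1
  let u := FreeGroup.of 2
  {s ^ q, t ^ q, u ^ p, t * s * t⁻¹ * s⁻¹, u * s * u⁻¹ * t⁻¹, u * t * u⁻¹ * (s ^ m * t ^ n)⁻¹}

abbrev Beta7 (p q m n : ℕ) : Type := PresentedGroup (beta7Rels p q m n)

end

/-!
Each of the groups is an extension of a cyclic group of order `p`, generated by an element `u`, by an
abelian normal subgroup `K` of order `q²`, and `u` does not centralize `K`. Only this is used for two
of the three assertions (`IsNoncentralExtension`).

* `K` contains every abelian normal subgroup `N`: an element `x ∈ N` outside `K` commutes with its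
  commutators with `K`, so these commutators have order dividing both `p` and `|K|`; then `x`
  centralizes `K`, and so does `u` because `K` is a maximal subgroup.
* Let `R = ∑ r(g, h) g ⊗ h` be a quasitriangular structure on `k[G]`. By
  `(Δ ⊗ id)(R) = R₁₃ R₂₃` the elements `ρ_g = ∑_h r(g, h) h` are orthogonal idempotents, and by
  `(id ⊗ Δ)(R) = R₁₃ R₁₂` every `h` that occurs in some `ρ_g` is a linear combination of them. Hence
  the `h` that occur commute (`commute_of_coeff_ne_zero`), and by symmetry so do the `g`. Both sets
  are stable under conjugation because `R` commutes with the elements `x ⊗ x`, so they generate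
  abelian normal subgroups and lie in `K`. Thus `R = ∑ f(a, b) e_a ⊗ e_b`, and in the basis of
  idempotents the axioms say that `f` is a bicharacter and that it is invariant under certain
  conjugations. Since `K` is maximal, invariance under one element outside `K` is the same as
  invariance under all of `G`, and the condition imposed on `w` is invariance under `u`, read off on
  generators of `K` (`isQuasitriangularStructure_iff`).

A compatible indexing exists as soon as `K` carries a nondegenerate pairing for which conjugation by
`u` is self-adjoint (`isConjCompatible_of_selfAdjoint`). In coordinates `K ≅ ℤ/q²` or `K ≅ (ℤ/q)²` it
is the product of `ℤ/q²` or a symmetric form on `(ℤ/q)²`: the standard one when `u` acts by a diagonal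
matrix, and the one with Gram matrix `(0 1; 1 n)` when it acts by the companion matrix `(0 m; 1 n)`.

The isomorphism of `K` with `ℤ/q²` or `(ℤ/q)²` comes from affine permutations of `ℤ/N` that satisfy
the defining relations, and for the last group from its order.
-/

/-! ### Coefficients of an R-matrix on a group algebra -/

section Coefficients

variable {k : Type*} [Field k] {G : Type*} [Group G]

/-- The coefficient at `x ⊗ y` of an element of `k[G] ⊗ k[G]`. -/
noncomputable def tensorCoeff (x y : G) : MonoidAlgebra k G ⊗[k] MonoidAlgebra k G →ₗ[k] k :=
  LinearMap.mul' k k ∘ₗ TensorProduct.map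
    (Finsupp.lapply x ∘ₗ (MonoidAlgebra.coeffLinearEquiv k).toLinearMap)
    (Finsupp.lapply y ∘ₗ (MonoidAlgebra.coeffLinearEquiv k).toLinearMap)

/-- The coefficient at `x ⊗ (y ⊗ z)` of an element of `k[G] ⊗ (k[G] ⊗ k[G])`. -/
noncomputable def tensorCoeff₃ (x y z : G) :
    MonoidAlgebra k G ⊗[k] (MonoidAlgebra k G ⊗[k] MonoidAlgebra k G) →ₗ[k] k :=
  LinearMap.mul' k k ∘ₗ TensorProduct.map
    (Finsupp.lapply x ∘ₗ (MonoidAlgebra.coeffLinearEquiv k).toLinearMap) (tensorCoeff y z)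

variable [DecidableEq G]

omit [Group G] in
lemma tensorCoeff_single (x y g h : G) :
    tensorCoeff (k := k) x y (.single g 1 ⊗ₜ .single h 1) =
      (if g = x then 1 else 0) * (if h = y then 1 else 0) := by
  simp [tensorCoeff, Finsupp.single_apply]

omit [Group G] in
lemma tensorCoeff₃_single (x y z g h l : G) :
    tensorCoeff₃ (k := k) x y z (.single g 1 ⊗ₜ (.single h 1 ⊗ₜ .single l 1)) =
      (if g = x then 1 else 0) * ((if h = y then 1 else 0) * (if l = z then 1 else 0)) := by
  simp [tensorCoeff₃, tensorCoeff_single, Finsupp.single_apply]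

variable [Fintype G]

omit [Group G] [DecidableEq G] in
lemma eq_sum_tensorCoeff (R : MonoidAlgebra k G ⊗[k] MonoidAlgebra k G) :
    R = ∑ g, ∑ h, tensorCoeff g h R • (.single g 1 ⊗ₜ .single h 1) := by
  induction R with
  | zero => simp
  | add x y hx hy =>
    simp only [map_add, add_smul, Finset.sum_add_distrib]
    rw [← hx, ← hy]
  | tmul a b =>
    have key (c : MonoidAlgebra k G) : c = ∑ g, c.coeff g • .single g 1 := by
      ext g
      simp
    conv_lhs => rw [key a, key b]
    rw [TensorProduct.sum_tmul]
    refine Finset.sum_congr rfl fun g _ => ?_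
    rw [TensorProduct.tmul_sum]
    refine Finset.sum_congr rfl fun h _ => ?_
    rw [TensorProduct.smul_tmul_smul]
    rfl

/-- The equation `(Δ ⊗ id)(R) = R₁₃ R₂₃` on coefficients. -/
lemma IsQuasitriangularStructure.sum_left {R : MonoidAlgebra k G ⊗[k] MonoidAlgebra k G}
    (hR : IsQuasitriangularStructure k R) (x y z : G) :
    (∑ a, ∑ b, if a * b = z then tensorCoeff x a R * tensorCoeff y b R else 0) =
      if x = y then tensorCoeff x z R else 0 := by
  have h := hR.comul_left
  generalize hr : (fun g h : G => tensorCoeff g h R) = r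
  have hr' (g h) : tensorCoeff g h R = r g h := by rw [← hr]
  have hR' := eq_sum_tensorCoeff R
  simp only [hr'] at hR' ⊢
  rw [hR'] at h
  have h' := congrArg (tensorCoeff₃ x y z) h
  simp only [R13, R23, map_sum, map_smul, LinearMap.rTensor_tmul, LinearMap.lTensor_tmul,
    TensorProduct.tmul_sum, TensorProduct.tmul_smul,
    MonoidAlgebra.comul_single, CommSemiring.comul_apply, TensorProduct.map_tmul,
    TensorProduct.assoc_tmul, Finset.sum_mul_sum, TensorProduct.mk_apply,
    Algebra.TensorProduct.tmul_mul_tmul, smul_mul_smul_comm, mul_one, one_mul,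
    MonoidAlgebra.lsingle_apply, MonoidAlgebra.single_mul_single, tensorCoeff₃_single] at h'
  simp only [smul_eq_mul] at h'
  rw [Finset.sum_eq_single x (by simp +contextual) (by simp),
    Finset.sum_eq_single z (by simp +contextual) (by simp),
    Finset.sum_eq_single x (by simp +contextual) (by simp),
    Finset.sum_eq_single y (by simp +contextual) (by simp)] at h'
  simpa using h'.symm

/-- The equation `(id ⊗ Δ)(R) = R₁₃ R₁₂` on coefficients. -/
lemma IsQuasitriangularStructure.sum_right {R : MonoidAlgebra k G ⊗[k] MonoidAlgebra k G}
    (hR : IsQuasitriangularStructure k R) (x y z : G) :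
    (∑ a, ∑ b, if a * b = z then tensorCoeff a x R * tensorCoeff b y R else 0) =
      if x = y then tensorCoeff z x R else 0 := by
  have h := hR.comul_right
  generalize hr : (fun g h : G => tensorCoeff g h R) = r
  have hr' (g h) : tensorCoeff g h R = r g h := by rw [← hr]
  have hR' := eq_sum_tensorCoeff R
  simp only [hr'] at hR' ⊢
  rw [hR'] at h
  have h' := congrArg (tensorCoeff₃ z y x) h
  simp only [R13, R12, map_sum, map_smul, LinearMap.lTensor_tmul,
    TensorProduct.sum_tmul, ← TensorProduct.smul_tmul',
    MonoidAlgebra.comul_single, CommSemiring.comul_apply, TensorProduct.map_tmul,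
    TensorProduct.assoc_tmul, Finset.sum_mul_sum, TensorProduct.mk_apply,
    Algebra.TensorProduct.tmul_mul_tmul, smul_mul_smul_comm, mul_one, one_mul,
    MonoidAlgebra.lsingle_apply, MonoidAlgebra.single_mul_single, tensorCoeff₃_single] at h'
  simp only [smul_eq_mul] at h'
  rw [Finset.sum_eq_single z (by simp +contextual) (by simp),
    Finset.sum_eq_single y (by simp +contextual) (by simp)] at h'
  have h₂ : ∀ a b : G, (∑ c, ∑ d, r a c * r b d * ((if a * b = z then 1 else 0) *
      ((if d = y then 1 else 0) * if c = x then 1 else 0))) =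
      if a * b = z then r a x * r b y else 0 := fun a b => by
    rw [Finset.sum_eq_single x (by simp +contextual) (by simp),
      Finset.sum_eq_single y (by simp +contextual) (by simp)]
    simp
  simp only [h₂] at h'
  rw [← h']
  by_cases hxy : x = y
  · simp [hxy]
  · simp [hxy, Ne.symm hxy]

/-- The equation `Δᵒᵖ(h) R = R Δ(h)` on coefficients. -/
lemma IsQuasitriangularStructure.tensorCoeff_conj {R : MonoidAlgebra k G ⊗[k] MonoidAlgebra k G}
    (hR : IsQuasitriangularStructure k R) (u x y : G) :
    tensorCoeff (u * x * u⁻¹) (u * y * u⁻¹) R = tensorCoeff x y R := by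
  have h := hR.comul_op (.single u 1)
  generalize hr : (fun g h : G => tensorCoeff g h R) = r
  have hr' (g h) : tensorCoeff g h R = r g h := by rw [← hr]
  have hR' := eq_sum_tensorCoeff R
  simp only [hr'] at hR' ⊢
  rw [hR'] at h
  have h' := congrArg (tensorCoeff (u * x) (u * y)) h
  simp only [map_sum, map_smul, MonoidAlgebra.comul_single, CommSemiring.comul_apply,
    TensorProduct.map_tmul, TensorProduct.comm_tmul, Finset.mul_sum, Finset.sum_mul,
    MonoidAlgebra.lsingle_apply, mul_smul_comm, smul_mul_assoc,
    Algebra.TensorProduct.tmul_mul_tmul, MonoidAlgebra.single_mul_single, mul_one,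
    tensorCoeff_single, smul_eq_mul, mul_right_inj] at h'
  rw [Finset.sum_eq_single x (by simp +contextual) (by simp),
    Finset.sum_eq_single y (by simp +contextual) (by simp),
    Finset.sum_eq_single (u * x * u⁻¹) (by simp +contextual [← eq_mul_inv_iff_mul_eq]) (by simp),
    Finset.sum_eq_single (u * y * u⁻¹) (by simp +contextual [← eq_mul_inv_iff_mul_eq]) (by simp)]
    at h'
  simpa using h'.symm

/-- The second legs of the terms of a solution `r` of the two coefficient equations commute.

In `k[G]` the elements `ρ_g = ∑_h r(g, h) h` are orthogonal idempotents by the first equation, and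
by the second every `h` with `r(g, h) ≠ 0` for some `g` is a linear combination of them. -/
lemma commute_of_coeff_ne_zero {r : G → G → k}
    (h₁ : ∀ x y z, (∑ a, ∑ b, if a * b = z then r x a * r y b else 0) =
      if x = y then r x z else 0)
    (h₂ : ∀ x y z, (∑ a, ∑ b, if a * b = z then r a x * r b y else 0) =
      if x = y then r z x else 0)
    {g g' h h' : G} (hg : r g h ≠ 0) (hg' : r g' h' ≠ 0) : h * h' = h' * h := by
  let ρ (x : G) : MonoidAlgebra k G := ∑ z, r x z • .single z 1
  have hρ (x y : G) : ρ x * ρ y = if x = y then ρ x else 0 := by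
    ext z
    have := h₁ x y z
    simp only [ρ, Finset.sum_mul_sum, smul_mul_smul_comm, MonoidAlgebra.single_mul_single, mul_one]
    split_ifs with hxy <;> simp_all [Finsupp.single_apply]
  have hcomm (x y : G) : Commute (ρ x) (ρ y) := by
    unfold Commute SemiconjBy
    rw [hρ, hρ]
    by_cases hxy : x = y
    · simp [hxy]
    · simp [hxy, Ne.symm hxy]
  have hspan (x y : G) : r x y • MonoidAlgebra.single y (1 : k) =
      ∑ a, ∑ b, if a * b = x then r a y • ρ b else 0 := by
    ext z
    have := h₂ y z x
    simp only [MonoidAlgebra.coeff_sum, Finsupp.coe_finsetSum, Finset.sum_apply]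
    have e (a b : G) : (if a * b = x then r a y • ρ b else 0).coeff z =
        if a * b = x then r a y * r b z else 0 := by
      split_ifs <;> simp [ρ, Finsupp.single_apply]
    simp only [e, this]
    simp [Finsupp.single_apply]
  have key : Commute (r g h • MonoidAlgebra.single h (1 : k))
      (r g' h' • MonoidAlgebra.single h' (1 : k)) := by
    rw [hspan, hspan]
    refine Commute.sum_left _ _ _ fun a _ => Commute.sum_left _ _ _ fun b _ =>
      Commute.sum_right _ _ _ fun c _ => Commute.sum_right _ _ _ fun d _ => ?_
    split_ifs
    · exact ((hcomm b d).smul_left _).smul_right _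
    all_goals simp
  have := key.eq
  simp only [smul_mul_smul_comm, MonoidAlgebra.single_mul_single, mul_one, mul_comm (r g' h')] at this
  have hne : r g h * r g' h' ≠ 0 := mul_ne_zero hg hg'
  exact MonoidAlgebra.single_left_injective one_ne_zero (smul_right_injective _ hne this)

/-- An R-matrix on `k[G]` is supported on `K × K`, where `K` is the largest abelian normal subgroup
of `G`. -/
lemma IsQuasitriangularStructure.mem_of_tensorCoeff_ne_zero
    {R : MonoidAlgebra k G ⊗[k] MonoidAlgebra k G} (hR : IsQuasitriangularStructure k R)
    {K : Subgroup G} (hK : IsLargestAbelianNormal K) {g h : G} (hgh : tensorCoeff g h R ≠ 0) :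
    g ∈ K ∧ h ∈ K := by
  -- A conjugation-invariant set of commuting elements generates an abelian normal subgroup.
  have main {B : Set G} (hB : ∀ x ∈ B, ∀ y ∈ B, x * y = y * x)
      (hc : ∀ x ∈ B, ∀ u : G, u * x * u⁻¹ ∈ B) : B ⊆ K := by
    have hBc : Group.conjugatesOfSet B = B := by
      refine Set.Subset.antisymm (fun x hx => ?_) Group.subset_conjugatesOfSet
      obtain ⟨a, ha, hax⟩ := Group.mem_conjugatesOfSet_iff.1 hx
      obtain ⟨u, rfl⟩ := isConj_iff.1 hax
      exact hc a ha u
    have hN : (Subgroup.closure B).Normal := by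
      have := Subgroup.normalClosure_normal (s := B)
      rwa [Subgroup.normalClosure, hBc] at this
    refine Subgroup.subset_closure.trans (hK.le _ hN fun x hx y hy => ?_)
    have := Subgroup.isMulCommutative_closure hB
    exact congrArg Subtype.val (this.is_comm.comm ⟨x, hx⟩ ⟨y, hy⟩)
  constructor
  · refine main (B := {x | ∃ y, tensorCoeff x y R ≠ 0}) ?_ ?_ ⟨h, hgh⟩
    · rintro x ⟨y, hx⟩ x' ⟨y', hx'⟩
      exact commute_of_coeff_ne_zero (r := fun a b => tensorCoeff b a R) hR.sum_right hR.sum_left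
        hx hx'
    · rintro x ⟨y, hx⟩ u
      exact ⟨u * y * u⁻¹, by rwa [hR.tensorCoeff_conj]⟩
  · refine main (B := {y | ∃ x, tensorCoeff x y R ≠ 0}) ?_ ?_ ⟨g, hgh⟩
    · rintro y ⟨x, hx⟩ y' ⟨x', hx'⟩
      exact commute_of_coeff_ne_zero hR.sum_left hR.sum_right hx hx'
    · rintro y ⟨x, hx⟩ u
      exact ⟨u * x * u⁻¹, by rwa [hR.tensorCoeff_conj]⟩

end Coefficients

/-! ### The idempotents indexed by `K` -/

section Idempotents

variable {k : Type*} [Field k] {G : Type*} [Group G] {K : Subgroup G} [Fintype K]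
  (θ : K ≃* (K →* kˣ))

lemma idem_eq_sum (a : K) :
    idem θ a = (Nat.card K : k)⁻¹ •
      ∑ x : K, ((θ a x⁻¹ : kˣ) : k) • MonoidAlgebra.single (x : G) (1 : k) := by
  simp [idem, finsum_eq_sum_of_fintype]

omit [Fintype K] in
include θ in
lemma mul_comm_of_mulEquiv_dual (a b : K) : a * b = b * a :=
  θ.injective (by rw [map_mul, map_mul]; exact mul_comm (θ a) (θ b))

lemma sum_dual_apply [DecidableEq K] (a : K) :
    ∑ x, ((θ a x : kˣ) : k) = if a = 1 then (Nat.card K : k) else 0 := by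
  split_ifs with h
  · simp [h]
  · refine sum_hom_units_eq_zero ((Units.coeHom k).comp (θ a)) fun h' => h ?_
    apply θ.injective
    ext x
    simpa using DFunLike.congr_fun h' x

variable [IsAlgClosed k] [CharZero k]

lemma sum_dual_apply' [DecidableEq K] (x : K) :
    ∑ a, ((θ a x : kˣ) : k) = if x = 1 then (Nat.card K : k) else 0 := by
  split_ifs with h
  · simp [h]
  · let _ : CommGroup K := { (inferInstance : Group K) with mul_comm := mul_comm_of_mulEquiv_dual θ }
    have : NeZero (Monoid.exponent K) := ⟨Monoid.exponent_ne_zero_of_finite⟩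
    obtain ⟨χ, hχ⟩ := CommGroup.exists_apply_ne_one_of_hasEnoughRootsOfUnity K k h
    refine sum_hom_units_eq_zero
      ((Units.coeHom k).comp ((MonoidHom.eval x).comp θ.toMonoidHom)) fun h' => hχ ?_
    have := DFunLike.congr_fun h' (θ.symm χ)
    simpa using this

/-- Fourier inversion on `K`. -/
lemma sum_smul_idem (x : K) :
    ∑ a, ((θ a x : kˣ) : k) • idem θ a = MonoidAlgebra.single (x : G) (1 : k) := by
  classical
  have hK : (Nat.card K : k) ≠ 0 := Nat.cast_ne_zero.2 Nat.card_pos.ne'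
  have h (y : K) : ∑ a, ((θ a x : kˣ) : k) * ((θ a y⁻¹ : kˣ) : k) =
      if y = x then (Nat.card K : k) else 0 := by
    have := sum_dual_apply' θ (x * y⁻¹)
    simp only [map_mul, Units.val_mul, mul_inv_eq_one] at this
    rw [this]
    simp [eq_comm]
  have e (a : K) : ((θ a x : kˣ) : k) • idem θ a = (Nat.card K : k)⁻¹ •
      ∑ y : K, (((θ a x : kˣ) : k) * ((θ a y⁻¹ : kˣ) : k)) • MonoidAlgebra.single (y : G) (1 : k) := by
    rw [idem_eq_sum, smul_comm, Finset.smul_sum]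
    simp_rw [smul_smul]
  rw [Finset.sum_congr rfl fun a _ => e a, ← Finset.smul_sum, Finset.sum_comm]
  simp_rw [← Finset.sum_smul, h, ite_smul, zero_smul]
  rw [Finset.sum_ite_eq' Finset.univ, if_pos (Finset.mem_univ _), smul_smul, inv_mul_cancel₀ hK,
    one_smul]

lemma sum_idem : ∑ a, idem θ a = (1 : MonoidAlgebra k G) := by
  have := sum_smul_idem θ 1
  simpa [MonoidAlgebra.one_def] using this

omit [IsAlgClosed k] [CharZero k] in
lemma single_mul_idem (x a : K) :
    MonoidAlgebra.single (x : G) (1 : k) * idem θ a = ((θ a x : kˣ) : k) • idem θ a := by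
  rw [idem_eq_sum, mul_smul_comm, smul_comm _ (Nat.card K : k)⁻¹, Finset.mul_sum]
  congr 1
  rw [← Equiv.sum_comp (Equiv.mulLeft x⁻¹), Finset.smul_sum]
  simp [mul_comm]

omit [IsAlgClosed k] in
lemma idem_mul_idem [DecidableEq K] (a b : K) :
    idem θ a * idem θ b = if a = b then idem θ a else 0 := by
  have hK : (Nat.card K : k) ≠ 0 := Nat.cast_ne_zero.2 Nat.card_pos.ne'
  have h := sum_dual_apply θ (a⁻¹ * b)
  simp only [map_mul, map_inv, MonoidHom.mul_apply, MonoidHom.inv_apply, Units.val_mul,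
    inv_mul_eq_one] at h
  conv_lhs => rw [idem_eq_sum]
  simp_rw [smul_mul_assoc, Finset.sum_mul, smul_mul_assoc, single_mul_idem, smul_smul, map_inv,
    ← Finset.sum_smul, h]
  split_ifs with hab
  · rw [hab, smul_smul, inv_mul_cancel₀ hK, one_smul]
  · simp

lemma comul_idem (a : K) :
    Coalgebra.comul (R := k) (idem θ a) = ∑ b, idem θ b ⊗ₜ[k] idem θ (b⁻¹ * a) := by
  classical
  have hK : (Nat.card K : k) ≠ 0 := Nat.cast_ne_zero.2 Nat.card_pos.ne'
  have h (b c : K) : ∑ x, ((θ a x⁻¹ : kˣ) : k) * (((θ b x : kˣ) : k) * ((θ c x : kˣ) : k)) =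
      if c = b⁻¹ * a then (Nat.card K : k) else 0 := by
    have h := sum_dual_apply θ (a⁻¹ * (b * c))
    simp only [map_mul, map_inv, MonoidHom.mul_apply, MonoidHom.inv_apply, Units.val_mul,
      inv_mul_eq_one] at h
    simp only [map_inv]
    rw [h]
    simp only [eq_inv_mul_iff_mul_eq, eq_comm]
  conv_lhs => rw [idem_eq_sum]
  have e (x : K) : ((θ a x⁻¹ : kˣ) : k) •
      Coalgebra.comul (R := k) (MonoidAlgebra.single (x : G) (1 : k)) =
      ∑ b, ∑ c, (((θ a x⁻¹ : kˣ) : k) * (((θ b x : kˣ) : k) * ((θ c x : kˣ) : k))) •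
        (idem θ b ⊗ₜ[k] idem θ c) := by
    rw [MonoidAlgebra.comul_single]
    simp only [CommSemiring.comul_apply, TensorProduct.map_tmul, MonoidAlgebra.lsingle_apply]
    rw [← sum_smul_idem θ x, TensorProduct.sum_tmul, Finset.smul_sum]
    refine Finset.sum_congr rfl fun b _ => ?_
    rw [TensorProduct.tmul_sum, Finset.smul_sum]
    refine Finset.sum_congr rfl fun c _ => ?_
    rw [TensorProduct.smul_tmul_smul, smul_smul]
  simp_rw [map_smul, map_sum, map_smul, e]
  rw [Finset.sum_comm, Finset.smul_sum]
  refine Finset.sum_congr rfl fun b _ => ?_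
  rw [Finset.sum_comm]
  simp_rw [← Finset.sum_smul, h, ite_smul, zero_smul]
  rw [Finset.sum_ite_eq' Finset.univ, if_pos (Finset.mem_univ _), smul_smul, inv_mul_cancel₀ hK,
    one_smul]

end Idempotents

/-! ### Elements of `k[K] ⊗ k[K]` in the basis of idempotents -/

section IdemTensor

variable {k : Type*} [Field k] [CharZero k] {G : Type*} [Group G] {K : Subgroup G} [Fintype K]
  (θ : K ≃* (K →* kˣ))

/-- `∑_{a,b ∈ K} f(a,b) e_a ⊗ e_b` for an arbitrary function `f`. -/
noncomputable def idemTensor (f : K → K → k) : MonoidAlgebra k G ⊗[k] MonoidAlgebra k G :=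
  ∑ a, ∑ b, f a b • (idem θ a ⊗ₜ[k] idem θ b)

/-- `∑_{a,b,c ∈ K} f(a,b,c) e_a ⊗ (e_b ⊗ e_c)`. -/
noncomputable def idemTensor₃ (f : K → K → K → k) :
    MonoidAlgebra k G ⊗[k] (MonoidAlgebra k G ⊗[k] MonoidAlgebra k G) :=
  ∑ a, ∑ b, ∑ c, f a b c • (idem θ a ⊗ₜ[k] (idem θ b ⊗ₜ[k] idem θ c))

omit [CharZero k] in
lemma bicharElement_eq_idemTensor (w : K →* K →* kˣ) :
    bicharElement θ w = idemTensor θ fun a b => ((w a b : kˣ) : k) := by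
  rw [bicharElement, finsum_eq_sum_of_fintype, Fintype.sum_prod_type]
  rfl

lemma idem_tmul_mul_idemTensor (f : K → K → k) (a b : K) :
    (idem θ a ⊗ₜ[k] idem θ b) * idemTensor θ f = f a b • (idem θ a ⊗ₜ[k] idem θ b) := by
  classical
  simp only [idemTensor, Finset.mul_sum, mul_smul_comm, Algebra.TensorProduct.tmul_mul_tmul,
    idem_mul_idem]
  rw [Finset.sum_eq_single a (fun x _ hx => by simp [Ne.symm hx]) (by simp),
    Finset.sum_eq_single b (fun x _ hx => by simp [Ne.symm hx]) (by simp)]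
  simp

/-- The linear form on `k[G]` that is dual to the idempotent `e_a`: it extends the character `θ_a`
by zero. -/
noncomputable def dualForm (a : K) : MonoidAlgebra k G →ₗ[k] k :=
  ∑ x : K, ((θ a x : kˣ) : k) •
    (Finsupp.lapply (x : G) ∘ₗ (MonoidAlgebra.coeffLinearEquiv k).toLinearMap)

lemma dualForm_idem [DecidableEq K] (a b : K) :
    dualForm θ a (idem θ b) = if a = b then 1 else 0 := by
  have hK : (Nat.card K : k) ≠ 0 := Nat.cast_ne_zero.2 Nat.card_pos.ne'
  have h := sum_dual_apply θ (b⁻¹ * a)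
  simp only [map_mul, map_inv, MonoidHom.mul_apply, MonoidHom.inv_apply, Units.val_mul,
    inv_mul_eq_one] at h
  have e (x : K) : (idem θ b).coeff x = (Nat.card K : k)⁻¹ * (((θ b x)⁻¹ : kˣ) : k) := by
    rw [idem_eq_sum]
    simp only [MonoidAlgebra.coeff_smul, MonoidAlgebra.coeff_sum, Finsupp.smul_apply,
      Finsupp.finsetSum_apply, MonoidAlgebra.coeff_single]
    rw [Finset.sum_eq_single x (by simp +contextual) (by simp)]
    simp
  have e' : dualForm θ a (idem θ b) =
      ∑ x : K, (Nat.card K : k)⁻¹ * ((((θ b x)⁻¹ : kˣ) : k) * ((θ a x : kˣ) : k)) := by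
    simp only [dualForm, LinearMap.sum_apply, LinearMap.smul_apply]
    refine Finset.sum_congr rfl fun x _ => ?_
    change ((θ a x : kˣ) : k) * (idem θ b).coeff x = _
    rw [e]
    ring
  rw [e', ← Finset.mul_sum, h]
  simp only [eq_comm (a := b)]
  split_ifs
  · exact inv_mul_cancel₀ hK
  · exact mul_zero _

lemma idem_tmul_ne_zero (a b : K) : idem θ a ⊗ₜ[k] idem θ b ≠ 0 := by
  classical
  intro h
  have := congrArg (LinearMap.mul' k k ∘ₗ TensorProduct.map (dualForm θ a) (dualForm θ b)) h
  simp [dualForm_idem] at this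

lemma idemTensor_injective : Function.Injective (idemTensor θ) := fun f g h => by
  ext a b
  have := congrArg ((idem θ a ⊗ₜ[k] idem θ b) * ·) h
  simp only [idem_tmul_mul_idemTensor] at this
  exact smul_left_injective k (idem_tmul_ne_zero θ a b) this

lemma idemTensor₃_injective : Function.Injective (idemTensor₃ θ) := fun f g h => by
  classical
  ext a b c
  have := congrArg (LinearMap.mul' k k ∘ₗ TensorProduct.map (dualForm θ a)
    (LinearMap.mul' k k ∘ₗ TensorProduct.map (dualForm θ b) (dualForm θ c))) h
  simpa [idemTensor₃, dualForm_idem] using this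

lemma idemTensor_mul (f g : K → K → k) :
    idemTensor θ f * idemTensor θ g = idemTensor θ (fun a b => f a b * g a b) := by
  conv_lhs => rw [idemTensor]
  simp only [Finset.sum_mul, smul_mul_assoc, idem_tmul_mul_idemTensor, smul_smul]
  rfl

variable [IsAlgClosed k]

lemma idemTensor_one : idemTensor θ (fun _ _ => 1) = 1 := by
  simp only [idemTensor, one_smul, ← TensorProduct.tmul_sum, ← TensorProduct.sum_tmul, sum_idem]
  rfl

lemma isUnit_idemTensor_iff (f : K → K → k) :
    IsUnit (idemTensor θ f) ↔ ∀ a b, f a b ≠ 0 := by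
  constructor
  · rintro h a b hab
    have := idem_tmul_mul_idemTensor θ f a b
    rw [hab, zero_smul] at this
    exact idem_tmul_ne_zero θ a b ((h.mul_left_eq_zero).1 this)
  · intro h
    exact isUnit_iff_exists.2 ⟨idemTensor θ fun a b => (f a b)⁻¹,
      by simp [idemTensor_mul, h, idemTensor_one], by simp [idemTensor_mul, h, idemTensor_one]⟩

lemma comul_rTensor_idemTensor (f : K → K → k) :
    TensorProduct.assoc k _ _ _ ((Coalgebra.comul (R := k)).rTensor _ (idemTensor θ f)) =
      idemTensor₃ θ fun a b c => f (a * b) c := by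
  simp only [idemTensor, idemTensor₃, map_sum, map_smul, LinearMap.rTensor_tmul, comul_idem,
    TensorProduct.sum_tmul, TensorProduct.assoc_tmul, Finset.smul_sum]
  rw [Finset.sum_congr rfl fun a _ => Finset.sum_comm, Finset.sum_comm]
  refine Finset.sum_congr rfl fun a _ => ?_
  rw [← Equiv.sum_comp (Equiv.mulLeft a)]
  simp

lemma comul_lTensor_idemTensor (f : K → K → k) :
    (Coalgebra.comul (R := k)).lTensor _ (idemTensor θ f) =
      idemTensor₃ θ fun a b c => f a (b * c) := by
  simp only [idemTensor, idemTensor₃, map_sum, map_smul, LinearMap.lTensor_tmul, comul_idem,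
    TensorProduct.tmul_sum, Finset.smul_sum]
  refine Finset.sum_congr rfl fun a _ => ?_
  rw [Finset.sum_comm]
  refine Finset.sum_congr rfl fun b _ => ?_
  rw [← Equiv.sum_comp (Equiv.mulLeft b)]
  simp

omit [IsAlgClosed k] in
lemma R13_mul_R23_idemTensor (f : K → K → k) :
    R13 k (idemTensor θ f) * R23 k (idemTensor θ f) =
      idemTensor₃ θ fun a b c => f a c * f b c := by
  classical
  simp only [idemTensor, idemTensor₃, R13, R23, map_sum, map_smul, LinearMap.lTensor_tmul,
    TensorProduct.tmul_sum, TensorProduct.tmul_smul, Finset.sum_mul_sum, TensorProduct.mk_apply,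
    Algebra.TensorProduct.tmul_mul_tmul, smul_mul_smul_comm, mul_one, one_mul, idem_mul_idem]
  refine Finset.sum_congr rfl fun a _ => ?_
  refine Finset.sum_congr rfl fun b _ => Finset.sum_congr rfl fun c _ => ?_
  rw [Finset.sum_eq_single c (fun x _ hx => by simp [Ne.symm hx]) (by simp)]
  simp

omit [IsAlgClosed k] in
lemma R13_mul_R12_idemTensor (f : K → K → k) :
    R13 k (idemTensor θ f) * R12 k (idemTensor θ f) =
      idemTensor₃ θ fun a b c => f a c * f a b := by
  classical
  simp only [idemTensor, idemTensor₃, R13, R12, map_sum, map_smul, LinearMap.lTensor_tmul,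
    TensorProduct.sum_tmul, ← TensorProduct.smul_tmul', TensorProduct.assoc_tmul,
    Finset.sum_mul_sum, TensorProduct.mk_apply,
    Algebra.TensorProduct.tmul_mul_tmul, smul_mul_smul_comm, mul_one, one_mul, idem_mul_idem]
  refine Finset.sum_congr rfl fun a _ => ?_
  rw [Finset.sum_eq_single a (fun x _ hx => by simp [Ne.symm hx]) (by simp), Finset.sum_comm]
  simp

end IdemTensor

/-! ### Noncentral extensions by a group of prime order -/

section Extension

variable {G : Type*} [Group G] {K : Subgroup G} {u : G} {p : ℕ}

lemma index_dvd_of_sup_zpowers_eq_top [K.Normal] (hu : u ^ p = 1)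
    (htop : K ⊔ Subgroup.zpowers u = ⊤) : K.index ∣ p := by
  have hgen : ∀ x : G ⧸ K, x ∈ Subgroup.zpowers (u : G ⧸ K) := by
    have h := congrArg (Subgroup.map (QuotientGroup.mk' K)) htop
    rw [Subgroup.map_sup, QuotientGroup.map_mk'_self, bot_sup_eq, MonoidHom.map_zpowers,
      Subgroup.map_top_of_surjective _ (QuotientGroup.mk'_surjective K)] at h
    intro x
    change x ∈ Subgroup.zpowers (QuotientGroup.mk' K u)
    rw [h]
    trivial
  have hord : orderOf (u : G ⧸ K) = K.index := orderOf_eq_card_of_forall_mem_zpowers hgen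
  rw [← hord]
  exact orderOf_dvd_of_pow_eq_one (by rw [← QuotientGroup.mk_pow, hu, QuotientGroup.mk_one])

/-- `G` is generated by a finite abelian normal subgroup `K` of order prime to `p` and an element `u`
with `u ^ p = 1` that does not centralize `K`. -/
structure IsNoncentralExtension (p : ℕ) (K : Subgroup G) (u : G) : Prop where
  normal : K.Normal
  comm : ∀ x ∈ K, ∀ y ∈ K, x * y = y * x
  finite : Finite K
  coprime : (Nat.card K).Coprime p
  pow_eq_one : u ^ p = 1
  sup_eq_top : K ⊔ Subgroup.zpowers u = ⊤
  exists_ne : ∃ v ∈ K, u * v ≠ v * u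

namespace IsNoncentralExtension

variable (hE : IsNoncentralExtension p K u)

include hE

lemma notMem : u ∉ K := fun hu => by
  obtain ⟨v, hv, h⟩ := hE.exists_ne
  exact h (hE.comm u hu v hv)

lemma index_eq (hp : p.Prime) : K.index = p := by
  have := hE.normal
  have hdvd := index_dvd_of_sup_zpowers_eq_top hE.pow_eq_one hE.sup_eq_top
  refine (hp.eq_one_or_self_of_dvd _ hdvd).resolve_left fun h1 => hE.notMem ?_
  rw [Subgroup.index_eq_one.1 h1]
  trivial

lemma finite_group (hp : p.Prime) : Finite G := by
  have := hE.finite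
  refine Nat.finite_of_card_ne_zero ?_
  rw [← K.card_mul_index, hE.index_eq hp]
  exact mul_ne_zero Nat.card_pos.ne' hp.ne_zero

/-- `K` is a maximal subgroup. -/
lemma eq_top_of_le (hp : p.Prime) {S : Subgroup G} (hS : K ≤ S) {y : G} (hy : y ∈ S)
    (hyK : y ∉ K) : S = ⊤ := by
  have h := Subgroup.relIndex_mul_index hS
  rw [hE.index_eq hp] at h
  rcases hp.eq_one_or_self_of_dvd _ (Dvd.intro_left _ h) with h1 | h1
  · exact Subgroup.index_eq_one.1 h1
  · rw [h1] at h
    have : K.relIndex S = 1 := by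
      simpa using Nat.eq_of_mul_eq_mul_right hp.pos (h.trans (one_mul p).symm)
    exact absurd (Subgroup.relIndex_eq_one.1 this hy) hyK

/-- An element `x ∉ K` of an abelian normal subgroup commutes with its commutators `[x, v]`,
`v ∈ K`. Hence `[x, v] ^ p = [x ^ p, v] = 1`, so that `[x, v] = 1` because `|K|` is prime to `p`,
and the extension would be central. -/
lemma isLargestAbelianNormal (hp : p.Prime) : IsLargestAbelianNormal K where
  normal := hE.normal
  comm := hE.comm
  ne_bot := by
    rintro rfl
    obtain ⟨v, hv, h⟩ := hE.exists_ne
    rw [Subgroup.mem_bot] at hv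
    simp [hv] at h
  le N hN hcomm x hx := by
    have hKn := hE.normal
    have := hE.finite
    by_contra hxK
    have hxv (v : G) (hv : v ∈ K) : x * v * x⁻¹ = v := by
      have hdN : x * v * x⁻¹ * v⁻¹ ∈ N := by
        simpa only [mul_assoc] using N.mul_mem hx (hN.conj_mem _ (N.inv_mem hx) v)
      have hdK : x * v * x⁻¹ * v⁻¹ ∈ K := K.mul_mem (hKn.conj_mem v hv x) (K.inv_mem hv)
      generalize hd : x * v * x⁻¹ * v⁻¹ = d at hdN hdK
      have hv' : x * v * x⁻¹ = d * v := by rw [← hd]; group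
      have hxd : x * d * x⁻¹ = d := by rw [hcomm x hx d hdN]; group
      have hpow (n : ℕ) : x ^ n * v * (x ^ n)⁻¹ = d ^ n * v := by
        induction n with
        | zero => simp
        | succ n ih =>
          calc x ^ (n + 1) * v * (x ^ (n + 1))⁻¹ = x * (x ^ n * v * (x ^ n)⁻¹) * x⁻¹ := by
                rw [pow_succ']; group
            _ = (x * d ^ n * x⁻¹) * (x * v * x⁻¹) := by rw [ih]; group
            _ = d ^ (n + 1) * v := by rw [← conj_pow, hxd, hv', pow_succ, mul_assoc]
      have hxp : x ^ p ∈ K := by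
        rw [← hE.index_eq hp]
        exact K.pow_index_mem x
      have hdp : d ^ p = 1 := by
        have := hpow p
        rw [hE.comm _ hxp v hv, mul_inv_cancel_right] at this
        exact (mul_eq_right.1 this.symm)
      have hdc : d ^ Nat.card K = 1 := by
        have := pow_card_eq_one' (x := (⟨d, hdK⟩ : K))
        exact congrArg Subtype.val this
      have : d = 1 := by
        have := pow_gcd_eq_one.2 ⟨hdc, hdp⟩
        rwa [hE.coprime, pow_one] at this
      rw [hv', this, one_mul]
    have htop : Subgroup.centralizer (K : Set G) = ⊤ :=
      hE.eq_top_of_le hp (fun a ha => Subgroup.mem_centralizer_iff.2 fun b hb => hE.comm b hb a ha)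
        (Subgroup.mem_centralizer_iff.2 fun b hb => (mul_inv_eq_iff_eq_mul.1 (hxv b hb)).symm) hxK
    obtain ⟨v, hv, h⟩ := hE.exists_ne
    have hu : u ∈ Subgroup.centralizer (K : Set G) := htop ▸ Subgroup.mem_top u
    exact h (Subgroup.mem_centralizer_iff.1 hu v hv).symm

end IsNoncentralExtension

end Extension

/-! ### Quasitriangular structures in terms of invariant bicharacters -/

section Classification

variable {k : Type*} [Field k] {G : Type*} [Group G] {K : Subgroup G} [K.Normal]

/-- The elements of `G` whose conjugation action on `K` preserves `w`. -/
def invarianceSubgroup (w : K →* K →* kˣ) : Subgroup G where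
  carrier := {g | ∀ a b, w (MulAut.conjNormal g a) (MulAut.conjNormal g b) = w a b}
  one_mem' := by simp
  mul_mem' {x y} hx hy a b := by simp only [map_mul, MulAut.mul_apply, hx _ _, hy _ _]
  inv_mem' {x} hx a b := by
    rw [← hx (MulAut.conjNormal x⁻¹ a) (MulAut.conjNormal x⁻¹ b)]
    congr 2 <;> simp [map_inv]

lemma conjNormal_of_comm (hK : ∀ x ∈ K, ∀ y ∈ K, x * y = y * x) {y : G} (hy : y ∈ K) (a : K) :
    MulAut.conjNormal y a = a := by
  ext
  rw [MulAut.conjNormal_apply, hK y hy a a.2, mul_inv_cancel_right]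

lemma le_invarianceSubgroup (hK : ∀ x ∈ K, ∀ y ∈ K, x * y = y * x) (w : K →* K →* kˣ) :
    K ≤ invarianceSubgroup w := fun y hy a b => by
  rw [conjNormal_of_comm hK hy, conjNormal_of_comm hK hy]

variable {θ : K ≃* (K →* kˣ)}

lemma IsConjCompatible.exists_mul_idem (hθ : IsConjCompatible θ) (x : G) :
    ∃ y : G, ∀ a, MonoidAlgebra.single x (1 : k) * idem θ a =
      idem θ (MulAut.conjNormal y a) * MonoidAlgebra.single x (1 : k) := by
  obtain ⟨y, hy⟩ := hθ x
  refine ⟨y, fun a => ?_⟩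
  obtain ⟨b, hb, h⟩ := hy a
  have : b = MulAut.conjNormal y a := by
    ext
    rw [hb, MulAut.conjNormal_apply]
  rw [← this, ← h, mul_assoc, MonoidAlgebra.single_mul_single]
  simp [← MonoidAlgebra.one_def]

variable [Fintype K]

lemma single_tmul_mul_idemTensor [CharZero k] {x y : G}
    (hxy : ∀ a, MonoidAlgebra.single x (1 : k) * idem θ a =
      idem θ (MulAut.conjNormal y a) * MonoidAlgebra.single x (1 : k)) (f : K → K → k) :
    (MonoidAlgebra.single x (1 : k) ⊗ₜ[k] MonoidAlgebra.single x (1 : k)) *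
        idemTensor θ (fun a b => f (MulAut.conjNormal y a) (MulAut.conjNormal y b)) =
      idemTensor θ f * (MonoidAlgebra.single x (1 : k) ⊗ₜ[k] MonoidAlgebra.single x (1 : k)) := by
  conv_rhs => rw [idemTensor, ← Equiv.sum_comp (MulAut.conjNormal y : MulAut K).toEquiv]
  simp only [idemTensor, Finset.mul_sum, Finset.sum_mul, mul_smul_comm, smul_mul_assoc,
    Algebra.TensorProduct.tmul_mul_tmul, hxy]
  refine Finset.sum_congr rfl fun a _ => ?_
  exact Equiv.sum_comp (MulAut.conjNormal y : MulAut K).toEquiv fun b =>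
    f (MulAut.conjNormal y a) b • ((idem θ (MulAut.conjNormal y a) * MonoidAlgebra.single x 1) ⊗ₜ[k]
      (idem θ b * MonoidAlgebra.single x 1))

variable [IsAlgClosed k] [CharZero k]

omit [K.Normal] in
variable (θ) in
lemma IsQuasitriangularStructure.exists_idemTensor [Finite G]
    {R : MonoidAlgebra k G ⊗[k] MonoidAlgebra k G}
    (hR : IsQuasitriangularStructure k R) (hK : IsLargestAbelianNormal K) :
    ∃ f, R = idemTensor θ f := by
  classical
  have := Fintype.ofFinite G
  have hmem : R ∈ Submodule.span k
      (Set.range fun ab : K × K => idem θ ab.1 ⊗ₜ[k] idem θ ab.2) := by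
    rw [eq_sum_tensorCoeff R]
    refine Submodule.sum_mem _ fun g _ => Submodule.sum_mem _ fun h _ => ?_
    by_cases hgh : tensorCoeff g h R = 0
    · rw [hgh, zero_smul]
      exact Submodule.zero_mem _
    · obtain ⟨hg, hh⟩ := hR.mem_of_tensorCoeff_ne_zero hK hgh
      refine Submodule.smul_mem _ _ ?_
      have eg := sum_smul_idem θ ⟨g, hg⟩
      have eh := sum_smul_idem θ ⟨h, hh⟩
      simp only at eg eh
      rw [← eg, ← eh, TensorProduct.sum_tmul]
      refine Submodule.sum_mem _ fun a _ => ?_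
      rw [TensorProduct.tmul_sum]
      refine Submodule.sum_mem _ fun b _ => ?_
      rw [TensorProduct.smul_tmul_smul]
      exact Submodule.smul_mem _ _ (Submodule.subset_span ⟨(a, b), rfl⟩)
  obtain ⟨c, hc⟩ := (Submodule.mem_span_range_iff_exists_fun k).1 hmem
  refine ⟨fun a b => c (a, b), ?_⟩
  rw [← hc, Fintype.sum_prod_type]
  rfl

/-- A bicharacter defines a quasitriangular structure as soon as all of `G` preserves it. -/
lemma isQuasitriangularStructure_bicharElement (hθ : IsConjCompatible θ) {w : K →* K →* kˣ}
    (hw : invarianceSubgroup w = ⊤) : IsQuasitriangularStructure k (bicharElement θ w) := by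
  rw [bicharElement_eq_idemTensor]
  refine ⟨(isUnit_idemTensor_iff θ _).2 fun a b => (w a b).ne_zero, ?_, ?_, fun h => ?_⟩
  · rw [comul_rTensor_idemTensor, R13_mul_R23_idemTensor]
    simp
  · rw [comul_lTensor_idemTensor, R13_mul_R12_idemTensor]
    simp [mul_comm]
  · induction h using MonoidAlgebra.induction_linear with
    | zero => simp
    | add x y hx hy => simp only [map_add, add_mul, mul_add, hx, hy]
    | single x c =>
      obtain ⟨y, hy⟩ := hθ.exists_mul_idem x
      have hyw : y ∈ invarianceSubgroup w := hw ▸ Subgroup.mem_top y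
      have key := single_tmul_mul_idemTensor hy fun a b => ((w a b : kˣ) : k)
      simp only [show ∀ a b, w (MulAut.conjNormal y a) (MulAut.conjNormal y b) = w a b from hyw]
        at key
      have e : MonoidAlgebra.single x c = c • MonoidAlgebra.single x (1 : k) := by simp
      rw [e, map_smul, map_smul, MonoidAlgebra.comul_single]
      simp only [CommSemiring.comul_apply, TensorProduct.map_tmul, MonoidAlgebra.lsingle_apply,
        TensorProduct.comm_tmul, smul_mul_assoc, mul_smul_comm, key]

theorem isQuasitriangularStructure_iff {p : ℕ} (hp : p.Prime) {u : G}
    (hE : IsNoncentralExtension p K u) (hθ : IsConjCompatible θ)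
    (R : MonoidAlgebra k G ⊗[k] MonoidAlgebra k G) :
    IsQuasitriangularStructure k R ↔ ∃ w : K →* K →* kˣ,
      (∀ a b, w (MulAut.conjNormal u a) (MulAut.conjNormal u b) = w a b) ∧
        R = bicharElement θ w := by
  constructor
  · intro hR
    have := hE.finite_group hp
    obtain ⟨f, rfl⟩ := hR.exists_idemTensor θ (hE.isLargestAbelianNormal hp)
    have hne := (isUnit_idemTensor_iff θ f).1 hR.isUnit
    have hl : ∀ a b c, f (a * b) c = f a c * f b c := by
      have := hR.comul_left
      rw [comul_rTensor_idemTensor, R13_mul_R23_idemTensor] at this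
      intro a b c
      exact congrFun (congrFun (congrFun (idemTensor₃_injective θ this) a) b) c
    have hr : ∀ a b c, f a (b * c) = f a c * f a b := by
      have := hR.comul_right
      rw [comul_lTensor_idemTensor, R13_mul_R12_idemTensor] at this
      intro a b c
      exact congrFun (congrFun (congrFun (idemTensor₃_injective θ this) a) b) c
    let w : K →* K →* kˣ := MonoidHom.mk' (fun a => MonoidHom.mk'
      (fun b => Units.mk0 (f a b) (hne a b)) fun b c => by ext; simp [hr, mul_comm])
      fun a b => by ext c; simp [hl]
    refine ⟨w, ?_, by rw [bicharElement_eq_idemTensor]; rfl⟩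
    obtain ⟨y, hy⟩ := hθ.exists_mul_idem u
    -- If `y ∈ K`, then `u` would commute with all the `e_a`, hence centralize `K`.
    have hyK : y ∉ K := fun hyK => by
      obtain ⟨v, hv, h⟩ := hE.exists_ne
      have e := sum_smul_idem θ ⟨v, hv⟩
      have : MonoidAlgebra.single u (1 : k) * MonoidAlgebra.single v (1 : k) =
          MonoidAlgebra.single v (1 : k) * MonoidAlgebra.single u (1 : k) := by
        simp only at e
        simp only [← e, Finset.mul_sum, Finset.sum_mul, mul_smul_comm, smul_mul_assoc, hy,
          conjNormal_of_comm hE.comm hyK]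
      simp only [MonoidAlgebra.single_mul_single, mul_one] at this
      exact h (MonoidAlgebra.single_left_injective one_ne_zero this)
    have hyw : y ∈ invarianceSubgroup w := by
      have h := hR.comul_op (.single u 1)
      simp only [MonoidAlgebra.comul_single, CommSemiring.comul_apply, TensorProduct.map_tmul,
        MonoidAlgebra.lsingle_apply, TensorProduct.comm_tmul] at h
      rw [← single_tmul_mul_idemTensor hy f] at h
      have h' := congrArg
        ((MonoidAlgebra.single u⁻¹ (1 : k) ⊗ₜ[k] MonoidAlgebra.single u⁻¹ (1 : k)) * ·) h
      simp only [← mul_assoc, Algebra.TensorProduct.tmul_mul_tmul, MonoidAlgebra.single_mul_single,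
        inv_mul_cancel, mul_one, ← MonoidAlgebra.one_def, ← Algebra.TensorProduct.one_def,
        one_mul] at h'
      intro a b
      ext
      exact (congrFun (congrFun (idemTensor_injective θ h') a) b).symm
    have htop := hE.eq_top_of_le hp (le_invarianceSubgroup hE.comm w) hyw hyK
    exact (htop ▸ Subgroup.mem_top u : u ∈ invarianceSubgroup w)
  · rintro ⟨w, hw, rfl⟩
    exact isQuasitriangularStructure_bicharElement hθ
      (hE.eq_top_of_le hp (le_invarianceSubgroup hE.comm w) (y := u) hw hE.notMem)

end Classification

/-! ### Compatible indexings from self-adjoint pairings -/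

section Pairing

variable {k : Type*} [Field k] {G : Type*} [Group G] {K : Subgroup G} [K.Normal] {u : G}

/-- An indexing `θ` for which conjugation by `u` is self-adjoint is compatible with conjugation:
conjugating `e_a` by `u` amounts to conjugating `a` by `u⁻¹`. -/
lemma isConjCompatible_of_selfAdjoint [Finite K] (hK : ∀ x ∈ K, ∀ y ∈ K, x * y = y * x)
    (hu : K ⊔ Subgroup.zpowers u = ⊤) (θ : K ≃* (K →* kˣ))
    (hθ : ∀ a b, θ (MulAut.conjNormal u a) b = θ a (MulAut.conjNormal u b)) :
    IsConjCompatible θ := by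
  have := Fintype.ofFinite K
  let T : Subgroup G :=
    { carrier := {x | ∃ y, ∀ a z : K, θ (MulAut.conjNormal y a) (MulAut.conjNormal x z) = θ a z}
      one_mem' := ⟨1, by simp⟩
      mul_mem' := by
        rintro x₁ x₂ ⟨y₁, h₁⟩ ⟨y₂, h₂⟩
        exact ⟨y₁ * y₂, fun a z => by simp only [map_mul, MulAut.mul_apply, h₁, h₂]⟩
      inv_mem' := by
        rintro x ⟨y, h⟩
        refine ⟨y⁻¹, fun a z => ?_⟩
        rw [← h (MulAut.conjNormal y⁻¹ a)]
        congr 2 <;> simp [map_inv] }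
  have hKT : K ≤ T := fun x hx => ⟨1, fun a z => by rw [conjNormal_of_comm hK hx]; simp⟩
  have huT : u ∈ T := ⟨u⁻¹, fun a z => by
    rw [← hθ]
    congr 2
    simp [map_inv]⟩
  have hT : T = ⊤ := top_unique (hu ▸ sup_le hKT (Subgroup.zpowers_le.2 huT))
  intro x
  obtain ⟨y, hy⟩ : x ∈ T := hT ▸ Subgroup.mem_top x
  refine ⟨y, fun a => ⟨MulAut.conjNormal y a, MulAut.conjNormal_apply y a, ?_⟩⟩
  rw [idem_eq_sum, idem_eq_sum, mul_smul_comm, smul_mul_assoc, Finset.mul_sum, Finset.sum_mul]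
  congr 1
  refine (Finset.sum_congr rfl fun z _ => ?_).trans
    (Equiv.sum_comp (MulAut.conjNormal x : MulAut K).toEquiv _)
  change _ = ((θ (MulAut.conjNormal y a) (MulAut.conjNormal x z)⁻¹ : kˣ) : k) •
    MonoidAlgebra.single ((MulAut.conjNormal x z : K) : G) (1 : k)
  rw [← map_inv, hy, MulAut.conjNormal_apply]
  simp [MonoidAlgebra.single_mul_single]

/-- A nondegenerate pairing `β : A × A → ℤ/N` on a group `A` isomorphic to `K`, for which the
automorphism `σ` given by conjugation by `u` is self-adjoint, yields a self-adjoint indexing. -/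
lemma exists_selfAdjoint_dual [IsAlgClosed k] [CharZero k]
    {A : Type*} [AddCommGroup A] [Finite A] {N : ℕ} [NeZero N] (e : Multiplicative A ≃* K)
    (β : A →+ A →+ ZMod N) (hβ : ∀ a, (∀ b, β a b = 0) → a = 0) (σ : A → A)
    (hσ : ∀ a, MulAut.conjNormal u (e (.ofAdd a)) = e (.ofAdd (σ a)))
    (hadj : ∀ a b, β (σ a) b = β a (σ b)) :
    ∃ θ : K ≃* (K →* kˣ),
      ∀ a b, θ (MulAut.conjNormal u a) b = θ a (MulAut.conjNormal u b) := by
  let _ : CommGroup K := { (inferInstance : Group K) with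
    mul_comm := fun a b => e.symm.injective (by rw [map_mul, map_mul, mul_comm]) }
  have : Finite K := Finite.of_equiv _ e.toEquiv
  obtain ⟨ζ, hζ⟩ := HasEnoughRootsOfUnity.exists_primitiveRoot k N
  obtain ⟨ζ, rfl⟩ := hζ.isUnit (NeZero.ne N)
  rw [IsPrimitiveRoot.coe_units_iff] at hζ
  let χ : Multiplicative (ZMod N) →* kˣ :=
    (Subgroup.zpowers ζ).subtype.comp (AddMonoidHom.toMultiplicativeLeft
      hζ.zmodEquivZPowers.toAddMonoidHom)
  have hχ : ∀ z, χ (.ofAdd z) = 1 → z = 0 := fun z hz =>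
    hζ.zmodEquivZPowers.injective (by
      rw [map_zero]
      exact Subtype.ext hz)
  let θ₀ : K →* (K →* kˣ) := MonoidHom.mk'
    (fun a => (χ.comp (AddMonoidHom.toMultiplicative (β (e.symm a).toAdd))).comp e.symm)
    fun a b => by
      ext x
      simp
  have hθ₀ (a b : K) : θ₀ a b = χ (.ofAdd (β (e.symm a).toAdd (e.symm b).toAdd)) := rfl
  have hinj : Function.Injective θ₀ := by
    refine (injective_iff_map_eq_one _).2 fun a ha => ?_
    refine e.symm.injective ?_
    rw [map_one]
    refine hβ _ fun b => hχ _ ?_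
    have := DFunLike.congr_fun ha (e (.ofAdd b))
    rw [hθ₀, MulEquiv.symm_apply_apply] at this
    exact this
  have : NeZero (Monoid.exponent K) := ⟨Monoid.exponent_ne_zero_of_finite⟩
  have hcard := CommGroup.card_monoidHom_of_hasEnoughRootsOfUnity K k
  have : Finite (K →* kˣ) := Nat.finite_of_card_ne_zero (by rw [hcard]; exact Nat.card_pos.ne')
  refine ⟨MulEquiv.ofBijective θ₀ (hinj.bijective_of_nat_card_le hcard.le), fun a b => ?_⟩
  have hσ' (a : K) : (e.symm (MulAut.conjNormal u a)).toAdd = σ (e.symm a).toAdd := by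
    have := hσ (e.symm a).toAdd
    simp only [ofAdd_toAdd, MulEquiv.apply_symm_apply] at this
    rw [this]
    simp
  change θ₀ _ _ = θ₀ _ _
  rw [hθ₀, hθ₀, hσ', hσ', hadj]

end Pairing

section Range

variable {G : Type*} [Group G] {p : ℕ} {u : G} {A : Type*} [AddCommGroup A]

lemma normal_range (hp : p.Prime) (φ : Multiplicative A →* G) (σ : A → A)
    (hσ : ∀ a, u * φ (.ofAdd a) * u⁻¹ = φ (.ofAdd (σ a))) (hu : u ^ p = 1)
    (htop : φ.range ⊔ Subgroup.zpowers u = ⊤) : φ.range.Normal := by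
  have hconj (n : ℕ) : ∀ x ∈ φ.range, u ^ n * x * (u ^ n)⁻¹ ∈ φ.range := by
    induction n with
    | zero => simp
    | succ n ih =>
      rintro _ ⟨a, rfl⟩
      have : u ^ (n + 1) * φ a * (u ^ (n + 1))⁻¹ = u ^ n * (u * φ a * u⁻¹) * (u ^ n)⁻¹ := by
        rw [pow_succ]; group
      rw [this]
      exact ih _ ⟨_, (hσ a.toAdd).symm⟩
  rw [← Subgroup.normalizer_eq_top_iff, eq_top_iff, ← htop]
  refine sup_le Subgroup.le_normalizer (Subgroup.zpowers_le.2 ?_)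
  refine Subgroup.mem_normalizer_iff.2 fun x => ⟨fun hx => by simpa using hconj 1 x hx, fun hx => ?_⟩
  have h1 : u ^ (p - 1) * u = 1 := by rw [← pow_succ, Nat.sub_add_cancel hp.one_le, hu]
  have h2 := hconj (p - 1) _ hx
  rw [eq_inv_of_mul_eq_one_left h1] at h2
  simpa [mul_assoc] using h2

lemma isNoncentralExtension_range (hp : p.Prime) [Finite A] (φ : Multiplicative A →* G)
    (hφ : Function.Injective φ) (σ : A → A)
    (hσ : ∀ a, u * φ (.ofAdd a) * u⁻¹ = φ (.ofAdd (σ a))) (hu : u ^ p = 1)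
    (hcop : (Nat.card A).Coprime p) (htop : φ.range ⊔ Subgroup.zpowers u = ⊤)
    (hne : ∃ a, σ a ≠ a) : IsNoncentralExtension p φ.range u where
  normal := normal_range hp φ σ hσ hu htop
  comm := by
    rintro _ ⟨a, rfl⟩ _ ⟨b, rfl⟩
    rw [← map_mul, ← map_mul, mul_comm]
  finite := Finite.of_surjective _ φ.rangeRestrict_surjective
  coprime := by
    rw [← Nat.card_congr (MonoidHom.ofInjective hφ).toEquiv]
    exact hcop
  pow_eq_one := hu
  sup_eq_top := htop
  exists_ne := by
    obtain ⟨a, ha⟩ := hne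
    refine ⟨φ (.ofAdd a), ⟨_, rfl⟩, fun h => ha ?_⟩
    have := hσ a
    rw [h, mul_inv_cancel_right] at this
    exact (hφ this).symm

end Range

section Coordinates

variable {k : Type*} [Field k] [IsAlgClosed k] [CharZero k] {G : Type*} [Group G]

omit [IsAlgClosed k] [CharZero k] in
lemma forall_conjNormal_eq_iff {S : Set G} [(Subgroup.closure S).Normal] (u : G)
    (w : Subgroup.closure S →* Subgroup.closure S →* kˣ) :
    (∀ a b, w (MulAut.conjNormal u a) (MulAut.conjNormal u b) = w a b) ↔
      ∀ a b : Subgroup.closure S, (a : G) ∈ S → (b : G) ∈ S →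
        w (MulAut.conjNormal u a) (MulAut.conjNormal u b) = w a b := by
  refine ⟨fun h a b _ _ => h a b, fun h => ?_⟩
  let c : Subgroup.closure S →* Subgroup.closure S :=
    (MulAut.conjNormal u : MulAut (Subgroup.closure S)).toMonoidHom
  have h₁ (a : Subgroup.closure S) (ha : (a : G) ∈ S) : (w (c a)).comp c = w a :=
    MonoidHom.eq_of_eqOn_dense Subgroup.closure_closure_coe_preimage fun b hb => h a b ha hb
  intro a b
  have h₂ : ((MonoidHom.eval b).comp (w : _ →* _ →* kˣ)) = (MonoidHom.eval (c b)).comp (w.comp c) :=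
    MonoidHom.eq_of_eqOn_dense Subgroup.closure_closure_coe_preimage fun a ha =>
      (DFunLike.congr_fun (h₁ a ha) b).symm
  exact (DFunLike.congr_fun h₂ a).symm

/-- The classification for a group `G` generated by the image `⟨S⟩` of an injective homomorphism
`φ : A → G` and an element `u` that acts on it as a nontrivial automorphism `σ` of `A`, self-adjoint
for some nondegenerate pairing on `A`. -/
theorem classification_of_coordinates {p : ℕ} (hp : p.Prime) {u : G} {S : Set G}
    {A : Type*} [AddCommGroup A] [Finite A] {N : ℕ} [NeZero N]
    (φ : Multiplicative A →* G) (hφ : Function.Injective φ) (hS : φ.range = Subgroup.closure S)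
    (σ : A → A) (hσ : ∀ a, u * φ (.ofAdd a) * u⁻¹ = φ (.ofAdd (σ a))) (hu : u ^ p = 1)
    (hcop : (Nat.card A).Coprime p) (htop : Subgroup.closure S ⊔ Subgroup.zpowers u = ⊤)
    (hne : ∃ a, σ a ≠ a)
    (β : A →+ A →+ ZMod N) (hβ : ∀ a, (∀ b, β a b = 0) → a = 0)
    (hadj : ∀ a b, β (σ a) b = β a (σ b))
    {C : (Subgroup.closure S →* Subgroup.closure S →* kˣ) → Prop}
    (hC : ∀ [(Subgroup.closure S).Normal] w, C w ↔
      ∀ a b : Subgroup.closure S, (a : G) ∈ S → (b : G) ∈ S →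
        w (MulAut.conjNormal u a) (MulAut.conjNormal u b) = w a b) :
    IsLargestAbelianNormal (Subgroup.closure S) ∧
      QuasitriangularStructuresGivenBy k (Subgroup.closure S) C := by
  have hE : IsNoncentralExtension p (Subgroup.closure S) u := by
    rw [← hS] at htop ⊢
    exact isNoncentralExtension_range hp φ hφ σ hσ hu hcop htop hne
  have := hE.normal
  have := hE.finite
  have := Fintype.ofFinite (Subgroup.closure S)
  refine ⟨hE.isLargestAbelianNormal hp, ?_, fun θ hθ R => ?_⟩
  · let e : Multiplicative A ≃* Subgroup.closure S :=
      (MonoidHom.ofInjective hφ).trans (MulEquiv.subgroupCongr hS)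
    obtain ⟨θ, hθ⟩ := exists_selfAdjoint_dual (k := k) (u := u) e β hβ σ
      (fun a => Subtype.ext (by
        rw [MulAut.conjNormal_apply]
        exact hσ a)) hadj
    exact ⟨θ, isConjCompatible_of_selfAdjoint hE.comm hE.sup_eq_top θ hθ⟩
  · simp only [hC, ← forall_conjNormal_eq_iff, isQuasitriangularStructure_iff hp hE hθ]

end Coordinates

/-! ### Groups generated by commuting elements of order dividing `q` and a further element -/

section Generators

variable {G : Type*} [Group G]

/-- The homomorphism `ℤ/N → G`, `1 ↦ s`, for an element `s` with `s ^ N = 1`. -/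
def zmodPowHom (N : ℕ) (s : G) (hs : s ^ N = 1) : Multiplicative (ZMod N) →* G :=
  AddMonoidHom.toMultiplicativeLeft (ZMod.lift N ⟨zmultiplesHom (Additive G) (.ofMul s), by
    simp [← ofMul_pow, hs]⟩)

lemma zmodPowHom_natCast (N : ℕ) (s : G) (hs : s ^ N = 1) (n : ℕ) :
    zmodPowHom N s hs (.ofAdd (n : ZMod N)) = s ^ n := by
  have : ((n : ℤ) : ZMod N) = (n : ZMod N) := by simp
  rw [← this]
  change Additive.toMul (ZMod.lift N _ ((n : ℤ) : ZMod N)) = _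
  rw [ZMod.lift_coe]
  simp

lemma range_zmodPowHom {N : ℕ} [NeZero N] (s : G) (hs : s ^ N = 1) :
    (zmodPowHom N s hs).range = Subgroup.closure {s} := by
  apply le_antisymm
  · rintro _ ⟨a, rfl⟩
    obtain ⟨x, rfl⟩ := Multiplicative.ofAdd.surjective a
    obtain ⟨n, rfl⟩ := ZMod.natCast_zmod_surjective x
    rw [zmodPowHom_natCast]
    exact pow_mem (Subgroup.subset_closure (Set.mem_singleton _)) _
  · rw [Subgroup.closure_le, Set.singleton_subset_iff]
    have := zmodPowHom_natCast N s hs 1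
    rw [pow_one] at this
    exact MonoidHom.mem_range.2 ⟨_, this⟩

variable {q : ℕ} [NeZero q] {s t : G}

/-- The homomorphism `(ℤ/q)² → G`, `(x, y) ↦ s ^ x t ^ y`, for commuting elements `s` and `t` with
`s ^ q = t ^ q = 1`. -/
def zmodPairHom (hs : s ^ q = 1) (ht : t ^ q = 1) (hst : Commute s t) :
    Multiplicative (ZMod q × ZMod q) →* G :=
  MonoidHom.mk'
    (fun a => zmodPowHom q s hs (.ofAdd a.toAdd.1) * zmodPowHom q t ht (.ofAdd a.toAdd.2))
    fun a b => by
      have h : ∀ x y : ZMod q,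
          Commute (zmodPowHom q s hs (.ofAdd x)) (zmodPowHom q t ht (.ofAdd y)) := by
        intro x y
        obtain ⟨n, rfl⟩ := ZMod.natCast_zmod_surjective x
        obtain ⟨l, rfl⟩ := ZMod.natCast_zmod_surjective y
        rw [zmodPowHom_natCast, zmodPowHom_natCast]
        exact hst.pow_pow n l
      simp only [toAdd_mul, Prod.fst_add, Prod.snd_add, ofAdd_add, map_mul]
      exact Commute.mul_mul_mul_comm (h _ _) _ _

lemma zmodPairHom_natCast (hs : s ^ q = 1) (ht : t ^ q = 1) (hst : Commute s t) (n l : ℕ) :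
    zmodPairHom hs ht hst (.ofAdd ((n : ZMod q), (l : ZMod q))) = s ^ n * t ^ l := by
  rw [← zmodPowHom_natCast q s hs, ← zmodPowHom_natCast q t ht]
  rfl

lemma range_zmodPairHom (hs : s ^ q = 1) (ht : t ^ q = 1) (hst : Commute s t) :
    (zmodPairHom hs ht hst).range = Subgroup.closure {s, t} := by
  apply le_antisymm
  · rintro _ ⟨a, rfl⟩
    obtain ⟨⟨x, y⟩, rfl⟩ := Multiplicative.ofAdd.surjective a
    obtain ⟨n, rfl⟩ := ZMod.natCast_zmod_surjective x
    obtain ⟨l, rfl⟩ := ZMod.natCast_zmod_surjective y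
    rw [zmodPairHom_natCast]
    exact mul_mem (pow_mem (Subgroup.subset_closure (by simp)) _)
      (pow_mem (Subgroup.subset_closure (by simp)) _)
  · rw [Subgroup.closure_le]
    rintro x (rfl | rfl)
    · exact ⟨_, (zmodPairHom_natCast hs ht hst 1 0).trans (by simp)⟩
    · exact ⟨_, (zmodPairHom_natCast hs ht hst 0 1).trans (by simp)⟩

lemma conj_zmodPairHom (hs : s ^ q = 1) (ht : t ^ q = 1) (hst : Commute s t) {u : G} {a b c d : ℕ}
    (hus : u * s * u⁻¹ = s ^ a * t ^ b) (hut : u * t * u⁻¹ = s ^ c * t ^ d) (x : ZMod q × ZMod q) :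
    u * zmodPairHom hs ht hst (.ofAdd x) * u⁻¹ =
      zmodPairHom hs ht hst (.ofAdd (a * x.1 + c * x.2, b * x.1 + d * x.2)) := by
  obtain ⟨x, y⟩ := x
  obtain ⟨n, rfl⟩ := ZMod.natCast_zmod_surjective x
  obtain ⟨l, rfl⟩ := ZMod.natCast_zmod_surjective y
  simp only [← Nat.cast_mul, ← Nat.cast_add]
  rw [zmodPairHom_natCast, zmodPairHom_natCast]
  calc u * (s ^ n * t ^ l) * u⁻¹ = (u * s * u⁻¹) ^ n * (u * t * u⁻¹) ^ l := by
        rw [conj_pow, conj_pow]; group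
    _ = (s ^ (a * n) * t ^ (b * n)) * (s ^ (c * l) * t ^ (d * l)) := by
        rw [hus, hut, (hst.pow_pow a b).mul_pow, (hst.pow_pow c d).mul_pow]
        simp only [pow_mul]
    _ = _ := by
        rw [pow_add, pow_add]
        exact Commute.mul_mul_mul_comm (hst.symm.pow_pow _ _) _ _

/-- The symmetric bilinear form on `(ℤ/q)²` with Gram matrix `(α β; β γ)`. -/
def gramPairing (α β γ : ZMod q) : ZMod q × ZMod q →+ ZMod q × ZMod q →+ ZMod q :=
  AddMonoidHom.mk' (fun x => AddMonoidHom.mk'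
    (fun y => α * (x.1 * y.1) + β * (x.1 * y.2 + x.2 * y.1) + γ * (x.2 * y.2))
    fun y z => by simp only [Prod.fst_add, Prod.snd_add]; ring)
    fun x y => by
      ext z
      all_goals
        simp
        try ring

end Generators

section TwoGenerators

variable {k : Type*} [Field k] [IsAlgClosed k] [CharZero k] {G : Type*} [Group G]

/-- The classification for `G = ⟨s, t, u⟩` with `⟨s, t⟩ ≅ (ℤ/q)²` and `u` acting on it by the matrix
`(a c; b d)`. The Gram matrix `(α β; β γ)` is that of a nondegenerate symmetric form for which this
matrix is self-adjoint. -/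
theorem classification_of_two_generators {p q : ℕ} (hp : p.Prime) (hq : q.Prime) (hpq : p < q)
    {s t u : G} (hs : s ^ q = 1) (ht : t ^ q = 1) (hu : u ^ p = 1) (hst : Commute s t)
    {a b c d : ℕ} (hus : u * s * u⁻¹ = s ^ a * t ^ b) (hut : u * t * u⁻¹ = s ^ c * t ^ d)
    (hgen : Subgroup.closure {s, t} ⊔ Subgroup.zpowers u = ⊤)
    (hinj : ∀ x y : ℕ, s ^ x * t ^ y = 1 → q ∣ x ∧ q ∣ y)
    (hne : (a : ZMod q) ≠ 1 ∨ (d : ZMod q) ≠ 1) {α β γ : ZMod q} (hdet : α * γ - β * β ≠ 0)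
    (hadj : a * β + b * γ = c * α + d * β)
    {C : (Subgroup.closure {s, t} →* Subgroup.closure {s, t} →* kˣ) → Prop}
    (hC : ∀ w, C w ↔
      ∀ f g, f = inClosureFst s t → g = inClosureSnd s t →
        w (f ^ a * g ^ b) (f ^ a * g ^ b) = w f f ∧ w (f ^ a * g ^ b) (f ^ c * g ^ d) = w f g ∧
        w (f ^ c * g ^ d) (f ^ a * g ^ b) = w g f ∧ w (f ^ c * g ^ d) (f ^ c * g ^ d) = w g g) :
    IsLargestAbelianNormal (Subgroup.closure {s, t}) ∧
      QuasitriangularStructuresGivenBy k (Subgroup.closure {s, t}) C := by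
  have := Fact.mk hq
  refine classification_of_coordinates hp (zmodPairHom hs ht hst) ?_ (range_zmodPairHom hs ht hst)
    (fun x => (a * x.1 + c * x.2, b * x.1 + d * x.2)) (conj_zmodPairHom hs ht hst hus hut) hu ?_
    hgen ?_ (gramPairing α β γ) ?_ ?_ ?_
  · refine (injective_iff_map_eq_one _).2 fun z hz => ?_
    obtain ⟨⟨x, y⟩, rfl⟩ := Multiplicative.ofAdd.surjective z
    obtain ⟨n, rfl⟩ := ZMod.natCast_zmod_surjective x
    obtain ⟨l, rfl⟩ := ZMod.natCast_zmod_surjective y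
    rw [zmodPairHom_natCast] at hz
    obtain ⟨h1, h2⟩ := hinj n l hz
    rw [(ZMod.natCast_eq_zero_iff n q).2 h1, (ZMod.natCast_eq_zero_iff l q).2 h2]
    rfl
  · have : p.Coprime q := (Nat.coprime_primes hp hq).2 hpq.ne
    rw [Nat.card_prod, Nat.card_zmod]
    exact (this.mul_right this).symm
  · rcases hne with h | h
    · exact ⟨(1, 0), fun h' => h (by simpa using congrArg Prod.fst h')⟩
    · exact ⟨(0, 1), fun h' => h (by simpa using congrArg Prod.snd h')⟩
  · rintro ⟨x, y⟩ h
    have h1 : α * x + β * y = 0 := by simpa [gramPairing] using h (1, 0)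
    have h2 : β * x + γ * y = 0 := by simpa [gramPairing] using h (0, 1)
    have hx : (α * γ - β * β) * x = 0 := by linear_combination γ * h1 - β * h2
    have hy : (α * γ - β * β) * y = 0 := by linear_combination α * h2 - β * h1
    rw [mul_eq_zero] at hx hy
    rw [hx.resolve_left hdet, hy.resolve_left hdet]
    rfl
  · rintro ⟨x, y⟩ ⟨z, w⟩
    simp only [gramPairing, AddMonoidHom.mk'_apply]
    linear_combination (x * w - y * z) * hadj
  · intro _ w
    rw [hC]
    have hf : MulAut.conjNormal u (inClosureFst s t) =
        inClosureFst s t ^ a * inClosureSnd s t ^ b := by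
      ext
      rw [MulAut.conjNormal_apply]
      exact hus
    have hg : MulAut.conjNormal u (inClosureSnd s t) =
        inClosureFst s t ^ c * inClosureSnd s t ^ d := by
      ext
      rw [MulAut.conjNormal_apply]
      exact hut
    constructor
    · intro h x y hx hy
      obtain ⟨h1, h2, h3, h4⟩ := h _ _ rfl rfl
      rw [← hf, ← hg] at h2 h3
      rw [← hf] at h1
      rw [← hg] at h4
      have hx' : x = inClosureFst s t ∨ x = inClosureSnd s t := hx.imp Subtype.ext Subtype.ext
      have hy' : y = inClosureFst s t ∨ y = inClosureSnd s t := hy.imp Subtype.ext Subtype.ext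
      rcases hx' with rfl | rfl <;> rcases hy' with rfl | rfl <;> assumption
    · rintro h _ _ rfl rfl
      rw [← hf, ← hg]
      have hs' : s ∈ ({s, t} : Set G) := by simp
      have ht' : t ∈ ({s, t} : Set G) := by simp
      exact ⟨h _ _ hs' hs', h _ _ hs' ht', h _ _ ht' hs', h _ _ ht' ht'⟩

theorem classification_of_one_generator {p N : ℕ} [NeZero N] (hp : p.Prime) (hpN : N.Coprime p)
    {s u : G} (hs : s ^ N = 1) (hu : u ^ p = 1) {m : ℕ} (hus : u * s * u⁻¹ = s ^ m)
    (hgen : Subgroup.closure {s} ⊔ Subgroup.zpowers u = ⊤)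
    (hinj : ∀ x : ℕ, s ^ x = 1 → N ∣ x) (hm : (m : ZMod N) ≠ 1) :
    IsLargestAbelianNormal (Subgroup.closure {s}) ∧
      QuasitriangularStructuresGivenBy k (Subgroup.closure {s})
        fun w => w (inClosure s ^ m) (inClosure s ^ m) = w (inClosure s) (inClosure s) := by
  refine classification_of_coordinates hp (zmodPowHom N s hs) ?_ ?_ (fun x => m * x) ?_ hu ?_
    hgen ⟨1, by simpa using hm⟩ (AddMonoidHom.mul : ZMod N →+ ZMod N →+ ZMod N) ?_ ?_ ?_
  · refine (injective_iff_map_eq_one _).2 fun z hz => ?_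
    obtain ⟨x, rfl⟩ := Multiplicative.ofAdd.surjective z
    obtain ⟨n, rfl⟩ := ZMod.natCast_zmod_surjective x
    rw [zmodPowHom_natCast] at hz
    rw [(ZMod.natCast_eq_zero_iff n N).2 (hinj n hz)]
    rfl
  · exact range_zmodPowHom s hs
  · intro x
    obtain ⟨n, rfl⟩ := ZMod.natCast_zmod_surjective x
    rw [← Nat.cast_mul, zmodPowHom_natCast, zmodPowHom_natCast, ← conj_pow, hus, pow_mul]
  · rwa [Nat.card_zmod]
  · intro a h
    simpa using h 1
  · intro a b
    simp only [AddMonoidHom.mul_apply]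
    ring
  · intro _ w
    have hf : MulAut.conjNormal u (inClosure s) = inClosure s ^ m := by
      ext
      rw [MulAut.conjNormal_apply]
      exact hus
    rw [← hf]
    refine ⟨fun h x y hx hy => ?_, fun h => h _ _ rfl rfl⟩
    obtain rfl : x = inClosure s := Subtype.ext hx
    obtain rfl : y = inClosure s := Subtype.ext hy
    exact h

end TwoGenerators

/-! ### The presented groups -/

/-- The translation `x ↦ x + 1` of `ℤ/N` and multiplication by `m` satisfy the relations between a
generator of `K` and `u`, and the translation has order exactly `N`. -/
lemma exists_translation_and_dilation {N p m : ℕ} (hp : p ≠ 0) (hm : m ^ p ≡ 1 [MOD N]) :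
    ∃ A M : Equiv.Perm (ZMod N), A ^ N = 1 ∧ M ^ p = 1 ∧ M * A * M⁻¹ = A ^ m ∧
      ∀ x : ℕ, A ^ x = 1 → N ∣ x := by
  have hm' : (m : ZMod N) ^ p = 1 := by
    have := (ZMod.natCast_eq_natCast_iff _ _ _).2 hm
    simpa using this
  let v : (ZMod N)ˣ := Units.ofPowEqOne (m : ZMod N) p hm' hp
  have hv : v ^ p = 1 := Units.pow_ofPowEqOne hm' hp
  have hpow (n : ℕ) : (Equiv.addRight (1 : ZMod N)) ^ n = Equiv.addRight (n : ZMod N) := by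
    ext x
    induction n with
    | zero => simp
    | succ n ih =>
      rw [pow_succ', Equiv.Perm.mul_apply, ih]
      simp [add_assoc]
  refine ⟨Equiv.addRight 1, MulAction.toPermHom (ZMod N)ˣ (ZMod N) v, ?_, ?_, ?_, fun x hx => ?_⟩
  · rw [hpow]
    ext x
    simp
  · rw [← map_pow, hv, map_one]
  · rw [mul_inv_eq_iff_eq_mul, hpow]
    ext x
    have : ((v : ZMod N)) = m := rfl
    simp [Units.smul_def, this]
  · rw [hpow] at hx
    have := DFunLike.congr_fun hx 0
    simpa [ZMod.natCast_eq_zero_iff] using this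

lemma natCast_zmod_ne_one {N m : ℕ} (h : ¬ m ≡ 1 [MOD N]) : (m : ZMod N) ≠ 1 := fun h' =>
  h ((ZMod.natCast_eq_natCast_iff _ _ _).1 (by simpa using h'))

lemma PresentedGroup.closure_sup_zpowers_eq_top {rels : Set (FreeGroup (Fin 3))} :
    Subgroup.closure {(PresentedGroup.of 0 : PresentedGroup rels), PresentedGroup.of 1} ⊔
      Subgroup.zpowers (PresentedGroup.of 2) = ⊤ := by
  rw [eq_top_iff, ← PresentedGroup.closure_range_of, Subgroup.closure_le]
  rintro _ ⟨i, rfl⟩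
  fin_cases i
  · exact Subgroup.mem_sup_left (Subgroup.subset_closure (by simp))
  · exact Subgroup.mem_sup_left (Subgroup.subset_closure (by simp))
  · exact Subgroup.mem_sup_right (Subgroup.mem_zpowers _)

section Cases

variable {k : Type*} [Field k] [IsAlgClosed k] [CharZero k] {p q : ℕ}

theorem classification_beta3 (hp : p.Prime) (hq : q.Prime) (hpq : p < q) {m : ℕ}
    (hm : m ^ p ≡ 1 [MOD q ^ 2]) (hm1 : ¬ m ≡ 1 [MOD q ^ 2]) :
    IsLargestAbelianNormal (Subgroup.closure {(PresentedGroup.of 0 : Beta3 p q m)}) ∧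
      QuasitriangularStructuresGivenBy k (Subgroup.closure {(PresentedGroup.of 0 : Beta3 p q m)})
        fun w => w (inClosure (PresentedGroup.of 0) ^ m) (inClosure (PresentedGroup.of 0) ^ m) =
          w (inClosure (PresentedGroup.of 0)) (inClosure (PresentedGroup.of 0)) := by
  have : NeZero (q ^ 2) := ⟨pow_ne_zero _ hq.ne_zero⟩
  have hr {r} (h : r ∈ beta3Rels p q m) : PresentedGroup.mk (beta3Rels p q m) r = 1 :=
    PresentedGroup.one_of_mem h
  refine classification_of_one_generator (N := q ^ 2) (u := PresentedGroup.of 1) hp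
    (((Nat.coprime_primes hq hp).2 hpq.ne').pow_left 2) (hr (by simp [beta3Rels]))
    (hr (by simp [beta3Rels]))
    (mul_inv_eq_one.1 (hr (r := FreeGroup.of 1 * FreeGroup.of 0 * (FreeGroup.of 1)⁻¹ *
      (FreeGroup.of 0 ^ m)⁻¹) (by simp [beta3Rels]))) ?_ ?_ (natCast_zmod_ne_one hm1)
  · rw [eq_top_iff, ← PresentedGroup.closure_range_of, Subgroup.closure_le]
    rintro _ ⟨i, rfl⟩
    fin_cases i
    · exact Subgroup.mem_sup_left (Subgroup.subset_closure (Set.mem_singleton _))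
    · exact Subgroup.mem_sup_right (Subgroup.mem_zpowers _)
  · obtain ⟨A, M, hA, hM, hMA, hx⟩ := exists_translation_and_dilation hp.ne_zero hm
    have hf : ∀ r ∈ beta3Rels p q m, FreeGroup.lift ![A, M] r = 1 := by
      simp [beta3Rels, hA, hM, hMA]
    intro x h
    refine hx x ?_
    have := congrArg (PresentedGroup.toGroup hf) h
    simpa using this

theorem classification_beta4 (hp : p.Prime) (hq : q.Prime) (hpq : p < q) {m : ℕ}
    (hm : m ^ p ≡ 1 [MOD q]) (hm1 : ¬ m ≡ 1 [MOD q]) :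
    let s₀ : Beta4 p q m := PresentedGroup.of 0
    let t₀ : Beta4 p q m := PresentedGroup.of 1
    let s := inClosureFst s₀ t₀
    let t := inClosureSnd s₀ t₀
    IsLargestAbelianNormal (Subgroup.closure {s₀, t₀}) ∧
      QuasitriangularStructuresGivenBy k (Subgroup.closure {s₀, t₀}) fun w =>
        w s (t ^ m) = w s t ∧ w (t ^ m) s = w t s ∧ w (t ^ m) (t ^ m) = w t t := by
  intro s₀ t₀ s t
  have hr {r} (h : r ∈ beta4Rels p q m) : PresentedGroup.mk (beta4Rels p q m) r = 1 :=
    PresentedGroup.one_of_mem h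
  have hus : PresentedGroup.of 2 * s₀ * (PresentedGroup.of 2)⁻¹ = s₀ :=
    mul_inv_eq_one.1 (hr (r := FreeGroup.of 2 * FreeGroup.of 0 * (FreeGroup.of 2)⁻¹ *
      (FreeGroup.of 0)⁻¹) (by simp [beta4Rels]))
  have hut : PresentedGroup.of 2 * t₀ * (PresentedGroup.of 2)⁻¹ = t₀ ^ m :=
    mul_inv_eq_one.1 (hr (r := FreeGroup.of 2 * FreeGroup.of 1 * (FreeGroup.of 2)⁻¹ *
      (FreeGroup.of 1 ^ m)⁻¹) (by simp [beta4Rels]))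
  have hts : t₀ * s₀ * t₀⁻¹ = s₀ :=
    mul_inv_eq_one.1 (hr (r := FreeGroup.of 1 * FreeGroup.of 0 * (FreeGroup.of 1)⁻¹ *
      (FreeGroup.of 0)⁻¹) (by simp [beta4Rels]))
  refine classification_of_two_generators (u := PresentedGroup.of 2) (a := 1) (b := 0) (c := 0)
    (d := m) (α := 1) (β := 0) (γ := 1) hp hq hpq
    (hr (by simp [beta4Rels])) (hr (by simp [beta4Rels])) (hr (by simp [beta4Rels]))
    (mul_inv_eq_iff_eq_mul.1 hts).symm (by simpa using hus) (by simpa using hut)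
    PresentedGroup.closure_sup_zpowers_eq_top ?_ (Or.inr (natCast_zmod_ne_one hm1)) ?_ (by simp) ?_
  · obtain ⟨A, M, hA, hM, hMA, hx⟩ := exists_translation_and_dilation hp.ne_zero hm
    have hf : ∀ r ∈ beta4Rels p q m, FreeGroup.lift ![A, 1, 1] r = 1 := by
      simp [beta4Rels, hA]
    have hg : ∀ r ∈ beta4Rels p q m, FreeGroup.lift ![1, A, M] r = 1 := by
      simp [beta4Rels, hA, hM, hMA]
    intro x y h
    have h1 := congrArg (PresentedGroup.toGroup hf) h
    have h2 := congrArg (PresentedGroup.toGroup hg) h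
    exact ⟨hx x (by simpa [s₀, t₀] using h1), hx y (by simpa [s₀, t₀] using h2)⟩
  · have := Fact.mk hq
    simp
  · intro w
    simp [s, t]

theorem classification_beta6 (hp : p.Prime) (hq : q.Prime) (hpq : p < q) {m n : ℕ}
    (hm : m ^ p ≡ 1 [MOD q]) (hn : n ^ p ≡ 1 [MOD q]) (hm1 : ¬ m ≡ 1 [MOD q]) :
    let s₀ : Beta6 p q m n := PresentedGroup.of 0
    let t₀ : Beta6 p q m n := PresentedGroup.of 1
    let s := inClosureFst s₀ t₀
    let t := inClosureSnd s₀ t₀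
    IsLargestAbelianNormal (Subgroup.closure {s₀, t₀}) ∧
      QuasitriangularStructuresGivenBy k (Subgroup.closure {s₀, t₀}) fun w =>
        w (s ^ m) (s ^ m) = w s s ∧ w (s ^ m) (t ^ n) = w s t ∧
        w (t ^ n) (s ^ m) = w t s ∧ w (t ^ n) (t ^ n) = w t t := by
  intro s₀ t₀ s t
  have hr {r} (h : r ∈ beta6Rels p q m n) : PresentedGroup.mk (beta6Rels p q m n) r = 1 :=
    PresentedGroup.one_of_mem h
  have hus : PresentedGroup.of 2 * s₀ * (PresentedGroup.of 2)⁻¹ = s₀ ^ m :=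
    mul_inv_eq_one.1 (hr (r := FreeGroup.of 2 * FreeGroup.of 0 * (FreeGroup.of 2)⁻¹ *
      (FreeGroup.of 0 ^ m)⁻¹) (by simp [beta6Rels]))
  have hut : PresentedGroup.of 2 * t₀ * (PresentedGroup.of 2)⁻¹ = t₀ ^ n :=
    mul_inv_eq_one.1 (hr (r := FreeGroup.of 2 * FreeGroup.of 1 * (FreeGroup.of 2)⁻¹ *
      (FreeGroup.of 1 ^ n)⁻¹) (by simp [beta6Rels]))
  have hts : t₀ * s₀ * t₀⁻¹ = s₀ :=
    mul_inv_eq_one.1 (hr (r := FreeGroup.of 1 * FreeGroup.of 0 * (FreeGroup.of 1)⁻¹ *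
      (FreeGroup.of 0)⁻¹) (by simp [beta6Rels]))
  refine classification_of_two_generators (u := PresentedGroup.of 2) (a := m) (b := 0) (c := 0)
    (d := n) (α := 1) (β := 0) (γ := 1) hp hq hpq
    (hr (by simp [beta6Rels])) (hr (by simp [beta6Rels])) (hr (by simp [beta6Rels]))
    (mul_inv_eq_iff_eq_mul.1 hts).symm (by simpa using hus) (by simpa using hut)
    PresentedGroup.closure_sup_zpowers_eq_top ?_ (Or.inl (natCast_zmod_ne_one hm1)) ?_ (by simp) ?_
  · obtain ⟨A, M, hA, hM, hMA, hx⟩ := exists_translation_and_dilation hp.ne_zero hm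
    obtain ⟨B, L, hB, hL, hLB, hy⟩ := exists_translation_and_dilation hp.ne_zero hn
    have hf : ∀ r ∈ beta6Rels p q m n, FreeGroup.lift ![A, 1, M] r = 1 := by
      simp [beta6Rels, hA, hM, hMA]
    have hg : ∀ r ∈ beta6Rels p q m n, FreeGroup.lift ![1, B, L] r = 1 := by
      simp [beta6Rels, hB, hL, hLB]
    intro x y h
    have h1 := congrArg (PresentedGroup.toGroup hf) h
    have h2 := congrArg (PresentedGroup.toGroup hg) h
    exact ⟨hx x (by simpa [s₀, t₀] using h1), hy y (by simpa [s₀, t₀] using h2)⟩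
  · have := Fact.mk hq
    simp
  · intro w
    simp [s, t]

theorem classification_beta7 (hp : p.Prime) (hq : q.Prime) (hpq : p < q) {m n : ℕ}
    (hcard : Nat.card (Beta7 p q m n) = p * q ^ 2) :
    let s₀ : Beta7 p q m n := PresentedGroup.of 0
    let t₀ : Beta7 p q m n := PresentedGroup.of 1
    let s := inClosureFst s₀ t₀
    let t := inClosureSnd s₀ t₀
    IsLargestAbelianNormal (Subgroup.closure {s₀, t₀}) ∧
      QuasitriangularStructuresGivenBy k (Subgroup.closure {s₀, t₀}) fun w =>
        w t t = w s s ∧ w t (s ^ m * t ^ n) = w s t ∧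
        w (s ^ m * t ^ n) t = w t s ∧ w (s ^ m * t ^ n) (s ^ m * t ^ n) = w t t := by
  intro s₀ t₀ s t
  have := Fact.mk hq
  have hr {r} (h : r ∈ beta7Rels p q m n) : PresentedGroup.mk (beta7Rels p q m n) r = 1 :=
    PresentedGroup.one_of_mem h
  have hs : s₀ ^ q = 1 := hr (r := FreeGroup.of 0 ^ q) (by simp [beta7Rels])
  have ht : t₀ ^ q = 1 := hr (r := FreeGroup.of 1 ^ q) (by simp [beta7Rels])
  have hu : (PresentedGroup.of 2 : Beta7 p q m n) ^ p = 1 :=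
    hr (r := FreeGroup.of 2 ^ p) (by simp [beta7Rels])
  have hus : PresentedGroup.of 2 * s₀ * (PresentedGroup.of 2)⁻¹ = s₀ ^ 0 * t₀ ^ 1 := by
    rw [pow_zero, one_mul, pow_one]
    exact mul_inv_eq_one.1 (hr (r := FreeGroup.of 2 * FreeGroup.of 0 * (FreeGroup.of 2)⁻¹ *
      (FreeGroup.of 1)⁻¹) (by simp [beta7Rels]))
  have hut : PresentedGroup.of 2 * t₀ * (PresentedGroup.of 2)⁻¹ = s₀ ^ m * t₀ ^ n :=
    mul_inv_eq_one.1 (hr (r := FreeGroup.of 2 * FreeGroup.of 1 * (FreeGroup.of 2)⁻¹ *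
      (FreeGroup.of 0 ^ m * FreeGroup.of 1 ^ n)⁻¹) (by simp [beta7Rels]))
  have hts : t₀ * s₀ * t₀⁻¹ = s₀ :=
    mul_inv_eq_one.1 (hr (r := FreeGroup.of 1 * FreeGroup.of 0 * (FreeGroup.of 1)⁻¹ *
      (FreeGroup.of 0)⁻¹) (by simp [beta7Rels]))
  have hst : Commute s₀ t₀ := (mul_inv_eq_iff_eq_mul.1 hts).symm
  have htop := PresentedGroup.closure_sup_zpowers_eq_top (rels := beta7Rels p q m n)
  -- `K` has index at most `p`, hence order at least `q²`, so `(ℤ/q)² → K` is injective.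
  have hinj : Function.Injective (zmodPairHom hs ht hst).rangeRestrict := by
    have htop' : (zmodPairHom hs ht hst).range ⊔
        Subgroup.zpowers (PresentedGroup.of 2 : Beta7 p q m n) = ⊤ := by
      rw [range_zmodPairHom]
      exact htop
    have hN := normal_range hp _ _ (conj_zmodPairHom hs ht hst hus hut) hu htop'
    have hidx := Nat.le_of_dvd hp.pos (index_dvd_of_sup_zpowers_eq_top hu htop')
    have hmul := (zmodPairHom hs ht hst).range.card_mul_index
    have hle : q ^ 2 ≤ Nat.card (zmodPairHom hs ht hst).range := by
      rw [hcard, mul_comm] at hmul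
      refine Nat.le_of_mul_le_mul_left ?_ hp.pos
      rw [← hmul]
      exact Nat.mul_le_mul_right _ hidx
    refine ((zmodPairHom hs ht hst).rangeRestrict_surjective.bijective_of_nat_card_le ?_).1
    refine le_trans (le_of_eq ?_) hle
    rw [Nat.card_congr Multiplicative.toAdd, Nat.card_prod, Nat.card_zmod, sq]
  refine classification_of_two_generators (u := PresentedGroup.of 2) (a := 0) (b := 1) (c := m)
    (d := n) (α := 0) (β := 1) (γ := n) hp hq hpq hs ht hu hst hus hut htop ?_
    (Or.inl (by simp)) (by simp) (by simp) ?_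
  · intro x y h
    rw [← zmodPairHom_natCast hs ht hst] at h
    have h' := (injective_iff_map_eq_one _).1 hinj _ (Subtype.ext h)
    have h'' : ((x : ZMod q), (y : ZMod q)) = 0 := h'
    rw [Prod.mk_eq_zero, ZMod.natCast_eq_zero_iff, ZMod.natCast_eq_zero_iff] at h''
    exact h''
  · intro w
    simp [s, t]

end Cases

theorem proposition3 {k : Type*} [Field k] [IsAlgClosed k] [CharZero k]
    (p q : ℕ) (hp : p.Prime) (hq : q.Prime) (hp2 : p ≠ 2) (hpq : p < q) :
    (p ∣ q ^ 2 - 1 → ∀ m : ℕ, m ^ p ≡ 1 [MOD q ^ 2] → ¬ m ≡ 1 [MOD q ^ 2] →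
        let s₀ : Beta3 p q m := PresentedGroup.of 0
        let s := inClosure s₀
        IsLargestAbelianNormal (Subgroup.closure {s₀}) ∧
        QuasitriangularStructuresGivenBy k (Subgroup.closure {s₀}) fun w =>
          w (s ^ m) (s ^ m) = w s s) ∧
    (p ∣ q - 1 → ∀ m : ℕ, m ^ p ≡ 1 [MOD q] → ¬ m ≡ 1 [MOD q] →
        let s₀ : Beta4 p q m := PresentedGroup.of 0
        let t₀ : Beta4 p q m := PresentedGroup.of 1
        let s := inClosureFst s₀ t₀
        let t := inClosureSnd s₀ t₀
        IsLargestAbelianNormal (Subgroup.closure {s₀, t₀}) ∧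
        QuasitriangularStructuresGivenBy k (Subgroup.closure {s₀, t₀}) fun w =>
          w s (t ^ m) = w s t ∧ w (t ^ m) s = w t s ∧
          w (t ^ m) (t ^ m) = w t t) ∧
    (p ∣ q - 1 → ∀ m : ℕ, m ^ p ≡ 1 [MOD q] → ¬ m ≡ 1 [MOD q] →
        let s₀ : Beta5 p q m := PresentedGroup.of 0
        let t₀ : Beta5 p q m := PresentedGroup.of 1
        let s := inClosureFst s₀ t₀
        let t := inClosureSnd s₀ t₀
        IsLargestAbelianNormal (Subgroup.closure {s₀, t₀}) ∧
        QuasitriangularStructuresGivenBy k (Subgroup.closure {s₀, t₀}) fun w =>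
          w (s ^ m) (s ^ m) = w s s ∧ w (s ^ m) (t ^ m) = w s t ∧
          w (t ^ m) (s ^ m) = w t s ∧ w (t ^ m) (t ^ m) = w t t) ∧
    (p ∣ q - 1 → ∀ m n : ℕ, m ^ p ≡ 1 [MOD q] → n ^ p ≡ 1 [MOD q] →
        ¬ m ≡ 1 [MOD q] → ¬ n ≡ 1 [MOD q] → ¬ m ≡ n [MOD q] →
        let s₀ : Beta6 p q m n := PresentedGroup.of 0
        let t₀ : Beta6 p q m n := PresentedGroup.of 1
        let s := inClosureFst s₀ t₀
        let t := inClosureSnd s₀ t₀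
        IsLargestAbelianNormal (Subgroup.closure {s₀, t₀}) ∧
        QuasitriangularStructuresGivenBy k (Subgroup.closure {s₀, t₀}) fun w =>
          w (s ^ m) (s ^ m) = w s s ∧ w (s ^ m) (t ^ n) = w s t ∧
          w (t ^ n) (s ^ m) = w t s ∧ w (t ^ n) (t ^ n) = w t t) ∧
    (p ∣ q + 1 → ∀ m n : ℕ, Nat.card (Beta7 p q m n) = p * q ^ 2 →
        let s₀ : Beta7 p q m n := PresentedGroup.of 0
        let t₀ : Beta7 p q m n := PresentedGroup.of 1
        let s := inClosureFst s₀ t₀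
        let t := inClosureSnd s₀ t₀
        IsLargestAbelianNormal (Subgroup.closure {s₀, t₀}) ∧
        QuasitriangularStructuresGivenBy k (Subgroup.closure {s₀, t₀}) fun w =>
          w t t = w s s ∧ w t (s ^ m * t ^ n) = w s t ∧
          w (s ^ m * t ^ n) t = w t s ∧ w (s ^ m * t ^ n) (s ^ m * t ^ n) = w t t) := by
  exact ⟨fun _ _ hm hm1 => classification_beta3 hp hq hpq hm hm1,
    fun _ _ hm hm1 => classification_beta4 hp hq hpq hm hm1,
    -- `β₅` is the case `m = n` of the presentation of `β₆`.
    fun _ _ hm hm1 => classification_beta6 hp hq hpq hm hm hm1,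
    fun _ _ _ hm hn hm1 _ _ => classification_beta6 hp hq hpq hm hn hm1,
    fun _ _ _ hcard => classification_beta7 hp hq hpq hcard⟩
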